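/- Let $\mathsf{SM}$ be the category of smooth supermanifolds: Hausdorff second countable topological spaces with a sheaf of supercommutative $\mathbb{R}$-algebras, locally isomorphic to open subspaces of the superspaces $\mathbb{R}^{p|q}=(\mathbb{R}^p, C^\infty\otimes\Lambda(\mathbb{R}^q))$, with morphisms the morphisms of superspaces (local on stalks). Let $\mathsf{SSM}$ be the category whose objects are the surjective submersions between supermanifolds and whose morphisms are the commutative squares. Fix $n\in\mathbb{N}$ and let $\mathsf{SSM}_n\subset\mathsf{SSM}$ be the full subcategory on the surjective submersions of the form $\mathbb{R}^{0|n}\times N\to N$ (that is, canonical projections of cartesian products in $\mathsf{SM}$), where $N$ runs through all supermanifolds; for every $N$ there is such an object. Let $\mathbf{Hom}(\mathbb{R}^{0|n},\mathbb{R}^{0|n})$ be the presheaf of monoids on $\mathsf{SM}$ given by $X\mapsto \mathrm{Hom}(\mathbb{R}^{0|n}\times X,\mathbb{R}^{0|n})$ with multiplication $(\varphi\psi)(\theta,x)=\varphi(\psi(\theta,x),x)$. Let $\widehat{\mathsf{SM}}_{[n]}$ be the category of presheaves of sets $G$ on $\mathsf{SM}$ with a right action $G\times\mathbf{Hom}(\mathbb{R}^{0|n},\mathbb{R}^{0|n})\to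 G$ of this presheaf of monoids, with the equivariant morphisms of presheaves as morphisms. For $G\in\widehat{\mathsf{SM}}_{[n]}$ define a presheaf on $\mathsf{SSM}_n$ by $(\mathbb{R}^{0|n}\times N\to N)\mapsto G(N)$, where a morphism $(\theta,x)\mapsto(\varphi(\theta,x),g(x))$ from $\mathbb{R}^{0|n}\times N_1\to N_1$ to $\mathbb{R}^{0|n}\times N_2\to N_2$, with $g:N_1\to N_2$ and $\varphi\in\mathbf{Hom}(\mathbb{R}^{0|n},\mathbb{R}^{0|n})(N_1)$, acts by $G(N_2)\to G(N_1)$, $a\mapsto (g^*a)\cdot\varphi$. This defines a functor from $\widehat{\mathsf{SM}}_{[n]}$ to the category $\widehat{\mathsf{SSM}_n}$ of presheaves of sets on $\mathsf{SSM}_n$, and this functor is an equivalence of categories. In particular the categories $\widehat{\mathsf{SSM}_n}$ and $\widehat{\mathsf{SM}}_{[n]}$ are equivalent. -/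

import Mathlib

open CategoryTheory TopologicalSpace Opposite
open scoped Manifold ContDiff

/-! ## Superspaces -/

/-- A superspace over `ℝ`: a topological space with a sheaf of supercommutative (`ℤ/2`-graded)
`ℝ`-algebras. The field `gr U 0` is the even part and `gr U 1` the odd part of the algebra of
sections over `U`. -/
structure Superspace : Type 1 where
  /-- the underlying topological space -/
  pt : Type
  [top : TopologicalSpace pt]
  /-- the sections of the structure sheaf -/
  sec : Opens pt → Type
  [ring : ∀ U, Ring (sec U)]
  [algebra : ∀ U, Algebra ℝ (sec U)]
  /-- restriction of sections -/
  res : ∀ {U V : Opens pt}, U ≤ V → sec V →ₐ[ℝ] sec U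
  res_self : ∀ {U : Opens pt} (s : sec U), res (le_refl U) s = s
  res_res : ∀ {U V W : Opens pt} (h : U ≤ V) (k : V ≤ W) (s : sec W),
    res h (res k s) = res (h.trans k) s
  /-- the even and the odd part -/
  gr : ∀ U : Opens pt, ZMod 2 → Submodule ℝ (sec U)
  gr_graded : ∀ U, SetLike.GradedMonoid (gr U)
  gr_internal : ∀ U, DirectSum.IsInternal (gr U)
  res_gr : ∀ {U V : Opens pt} (h : U ≤ V) (i : ZMod 2) (s : sec V), s ∈ gr V i → res h s ∈ gr U i
  supercomm : ∀ {U : Opens pt} {i j : ZMod 2} {a b : sec U}, a ∈ gr U i → b ∈ gr U j →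
    a * b = (-1 : ℤˣ) ^ (i * j) • (b * a)
  /-- sections are determined locally -/
  separated : ∀ {ι : Type} {U : Opens pt} (V : ι → Opens pt) (hV : ∀ i, V i ≤ U),
    (∀ x ∈ U, ∃ i, x ∈ V i) → ∀ s t : sec U, (∀ i, res (hV i) s = res (hV i) t) → s = t
  /-- compatible local sections can be glued -/
  glue : ∀ {ι : Type} {U : Opens pt} (V : ι → Opens pt) (hV : ∀ i, V i ≤ U),
    (∀ x ∈ U, ∃ i, x ∈ V i) → ∀ s : ∀ i, sec (V i),
    (∀ i j, res (inf_le_left : V i ⊓ V j ≤ V i) (s i) =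
      res (inf_le_right : V i ⊓ V j ≤ V j) (s j)) →
    ∃ t : sec U, ∀ i, res (hV i) t = s i

attribute [instance] Superspace.top Superspace.ring Superspace.algebra

namespace Superspace

/-- The section `s` is invertible in some neighbourhood of `x`, i.e. its germ at `x` is a unit. -/
def InvertibleAt (X : Superspace) {U : Opens X.pt} (s : X.sec U) (x : X.pt) : Prop :=
  ∃ (W : Opens X.pt) (h : W ≤ U), x ∈ W ∧ IsUnit (X.res h s)

/-- A morphism of superspaces: a continuous map `base` together with a morphism `app` of sheaves of
superalgebras from the structure sheaf of `Y` to the direct image of the structure sheaf of `X`,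
which is local on the stalks. -/
structure Hom (X Y : Superspace) where
  base : C(X.pt, Y.pt)
  app : ∀ V : Opens Y.pt, Y.sec V →ₐ[ℝ] X.sec (Opens.comap base V)
  app_res : ∀ {V W : Opens Y.pt} (h : V ≤ W) (s : Y.sec W),
    app V (Y.res h s) = X.res (OrderHomClass.mono (Opens.comap base) h) (app W s)
  app_gr : ∀ (V : Opens Y.pt) (i : ZMod 2) (s : Y.sec V), s ∈ Y.gr V i →
    app V s ∈ X.gr (Opens.comap base V) i
  isLocal : ∀ (V : Opens Y.pt) (s : Y.sec V) (x : X.pt), base x ∈ V →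
    X.InvertibleAt (app V s) x → Y.InvertibleAt s (base x)

instance : Category Superspace where
  Hom := Hom
  id X :=
    { base := ContinuousMap.id X.pt
      app := fun V => AlgHom.id ℝ (X.sec V)
      app_res := fun _ _ => rfl
      app_gr := fun _ _ _ hs => hs
      isLocal := fun _ _ _ _ h => h }
  comp f g :=
    { base := g.base.comp f.base
      app := fun V => (f.app (Opens.comap g.base V)).comp (g.app V)
      app_res := fun h s =>
        (congrArg (f.app _) (g.app_res h s)).trans (f.app_res _ _)
      app_gr := fun V i s hs => f.app_gr _ i _ (g.app_gr V i s hs)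
      isLocal := fun V s x hx h => g.isLocal V s (f.base x) hx (f.isLocal _ _ x hx h) }
  id_comp _ := rfl
  comp_id _ := rfl
  assoc _ _ _ := rfl

/-- The image in `X` of an open subset `W` of an open subset `U` of `X`. -/
def image {T : Type} [TopologicalSpace T] (U : Opens T) (W : Opens U) : Opens T :=
  ⟨Subtype.val '' (W : Set U), U.isOpen.isOpenMap_subtype_val _ W.isOpen⟩

theorem image_mono {T : Type} [TopologicalSpace T] (U : Opens T) {W W' : Opens U} (h : W ≤ W') :
    image U W ≤ image U W' :=
  Set.image_mono h

/-- The open subspace `U` of a superspace, with the restricted structure sheaf. -/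
def restrict (X : Superspace) (U : Opens X.pt) : Superspace where
  pt := U
  sec W := X.sec (image U W)
  res h := X.res (image_mono U h)
  res_self s := X.res_self s
  res_res _ _ s := X.res_res _ _ s
  gr W := X.gr (image U W)
  gr_graded _ := X.gr_graded _
  gr_internal _ := X.gr_internal _
  res_gr _ i s hs := X.res_gr _ i s hs
  supercomm ha hb := X.supercomm ha hb
  separated V hV hc s t h := by
    refine X.separated (fun i => image U (V i)) (fun i => image_mono U (hV i)) ?_ s t h
    rintro _ ⟨x, hx, rfl⟩
    obtain ⟨i, hi⟩ := hc x hx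
    exact ⟨i, x, hi, rfl⟩
  glue V hV hc s h := by
    refine X.glue (fun i => image U (V i)) (fun i => image_mono U (hV i)) ?_ s ?_
    · rintro _ ⟨x, hx, rfl⟩
      obtain ⟨i, hi⟩ := hc x hx
      exact ⟨i, x, hi, rfl⟩
    · intro i j
      have key : image U (V i) ⊓ image U (V j) ≤ image U (V i ⊓ V j) := by
        rintro _ ⟨⟨x, hx, rfl⟩, ⟨y, hy, hxy⟩⟩
        obtain rfl : y = x := Subtype.ext hxy
        exact ⟨y, ⟨hx, hy⟩, rfl⟩
      have := congrArg (X.res key) (h i j)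
      rwa [X.res_res, X.res_res] at this

end Superspace

/-! ## The superspaces `ℝ^{p|q}` -/

/-- The Grassmann algebra on `q` generators. -/
abbrev Grassmann (q : ℕ) : Type := ExteriorAlgebra ℝ (Fin q → ℝ)

/-- The even (`i = 0`) and the odd (`i = 1`) part of the Grassmann algebra. -/
abbrev Grassmann.gr (q : ℕ) (i : ZMod 2) : Submodule ℝ (Grassmann q) :=
  CliffordAlgebra.evenOdd (0 : QuadraticForm ℝ (Fin q → ℝ)) i

namespace Grassmann

instance (q : ℕ) : Module.Finite ℝ (Grassmann q) :=
  Module.Finite.of_basis (Pi.basisFun ℝ (Fin q)).ExteriorAlgebra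

theorem supercomm {q : ℕ} {i j : ZMod 2} {a b : Grassmann q} (ha : a ∈ gr q i) (hb : b ∈ gr q j) :
    a * b = (-1 : ℤˣ) ^ (i * j) • (b * a) := by
  have h := CliffordAlgebra.map_mul_map_of_isOrtho_of_mem_evenOdd
    (QuadraticMap.Isometry.id (0 : QuadraticForm ℝ (Fin q → ℝ)))
    (QuadraticMap.Isometry.id (0 : QuadraticForm ℝ (Fin q → ℝ)))
    (fun x y => by simp [QuadraticMap.isOrtho_def]) a b ha hb
  rw [CliffordAlgebra.map_id] at h
  rw [mul_comm i j]
  exact h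

end Grassmann

/-- A function on an open subset of `ℝ^p` with values in the (finite-dimensional) Grassmann algebra
is smooth if its composition with each linear functional (equivalently, each of its components in a
basis) is smooth. -/
def IsSmoothGrassmann {p q : ℕ} (U : Opens (EuclideanSpace ℝ (Fin p))) (f : U → Grassmann q) :
    Prop :=
  ∀ φ : Module.Dual ℝ (Grassmann q),
    ContMDiff 𝓘(ℝ, EuclideanSpace ℝ (Fin p)) 𝓘(ℝ, ℝ) ∞ (fun x => φ (f x))

theorem IsSmoothGrassmann.mul {p q : ℕ} {U : Opens (EuclideanSpace ℝ (Fin p))}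
    {f g : U → Grassmann q} (hf : IsSmoothGrassmann U f) (hg : IsSmoothGrassmann U g) :
    IsSmoothGrassmann U (f * g) := by
  intro φ
  let b := (Pi.basisFun ℝ (Fin q)).ExteriorAlgebra
  have h : (fun x => φ ((f * g) x)) = fun x => ∑ i, ∑ j,
      b.coord i (f x) * (b.coord j (g x) * φ (b i * b j)) := by
    funext x
    rw [Pi.mul_apply]
    conv_lhs => rw [← b.sum_repr (f x), ← b.sum_repr (g x), Finset.sum_mul_sum]
    simp only [map_sum, smul_mul_smul_comm, map_smul, smul_eq_mul, mul_assoc,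
      Module.Basis.coord_apply]
  rw [h]
  refine contMDiff_finsetSum fun i _ => contMDiff_finsetSum fun j _ => ?_
  exact (hf _).mul ((hg _).mul contMDiff_const)

/-- The algebra `C^∞(U) ⊗ Λ(ℝ^q)` of smooth functions on `U ⊆ ℝ^p` with values in the Grassmann
algebra. -/
def smoothGrassmann (p q : ℕ) (U : Opens (EuclideanSpace ℝ (Fin p))) :
    Subalgebra ℝ (U → Grassmann q) where
  carrier := {f | IsSmoothGrassmann U f}
  mul_mem' hf hg := hf.mul hg
  add_mem' {f g} hf hg φ := by
    have e : (fun x => φ ((f + g) x)) = (fun x => φ (f x)) + fun x => φ (g x) :=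
      funext fun x => map_add φ (f x) (g x)
    rw [e]
    exact (hf φ).add (hg φ)
  algebraMap_mem' c φ :=
    (contMDiff_const : ContMDiff _ _ _ fun _ : U => φ (algebraMap ℝ (Grassmann q) c))

theorem mem_smoothGrassmann {p q : ℕ} {U : Opens (EuclideanSpace ℝ (Fin p))} {f : U → Grassmann q} :
    f ∈ smoothGrassmann p q U ↔ IsSmoothGrassmann U f :=
  Iff.rfl

/-- The superspace `ℝ^{p|q}`. -/
def superEuclidean (p q : ℕ) : Superspace where
  pt := EuclideanSpace ℝ (Fin p)
  sec U := smoothGrassmann p q U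
  res {U V} h :=
    { toFun := fun f => ⟨fun x => f.1 ⟨x.1, h x.2⟩, mem_smoothGrassmann.2 fun φ =>
        (mem_smoothGrassmann.1 f.2 φ).comp (contMDiff_inclusion h)⟩
      map_one' := rfl
      map_mul' := fun _ _ => rfl
      map_zero' := rfl
      map_add' := fun _ _ => rfl
      commutes' := fun _ => rfl }
  res_self _ := rfl
  res_res _ _ _ := rfl
  gr U i :=
    { carrier := {f | ∀ x, f.1 x ∈ Grassmann.gr q i}
      add_mem' := fun hf hg x => add_mem (hf x) (hg x)
      zero_mem' := fun _ => zero_mem _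
      smul_mem' := fun c _ hf x => Submodule.smul_mem _ c (hf x) }
  gr_graded U :=
    { one_mem := fun _ => SetLike.GradedOne.one_mem
      mul_mem := fun _ _ _ _ hf hg x => SetLike.GradedMul.mul_mem (hf x) (hg x) }
  gr_internal U := by
    rw [DirectSum.isInternal_submodule_iff_isCompl _ (i := 0) (j := 1) (by decide)
      (by ext i; revert i; simp; decide)]
    have hc := CliffordAlgebra.evenOdd_isCompl (0 : QuadraticForm ℝ (Fin q → ℝ))
    constructor
    · rw [Submodule.disjoint_def]
      intro f h0 h1
      ext x
      exact Submodule.disjoint_def.mp hc.disjoint _ (h0 x) (h1 x)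
    · rw [codisjoint_iff, eq_top_iff]
      intro f _
      rw [Submodule.mem_sup]
      refine ⟨⟨fun x => (Submodule.projectionOnto _ _ hc (f.1 x) : Grassmann q),
          mem_smoothGrassmann.2 fun φ => mem_smoothGrassmann.1 f.2
            (φ ∘ₗ Submodule.subtype _ ∘ₗ Submodule.projectionOnto _ _ hc)⟩, fun x => ?_,
        ⟨fun x => (Submodule.projectionOnto _ _ hc.symm (f.1 x) : Grassmann q),
          mem_smoothGrassmann.2 fun φ => mem_smoothGrassmann.1 f.2
            (φ ∘ₗ Submodule.subtype _ ∘ₗ Submodule.projectionOnto _ _ hc.symm)⟩,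
        fun x => ?_, ?_⟩
      · exact Subtype.property _
      · exact Subtype.property _
      · ext x
        exact Submodule.projection_add_projection_eq_self hc (f.1 x)
  res_gr h i s hs x := hs _
  supercomm ha hb := by
    ext x
    exact Grassmann.supercomm (ha x) (hb x)
  separated V hV hc s t h := by
    ext ⟨x, hx⟩
    obtain ⟨i, hi⟩ := hc x hx
    exact congrFun (congrArg Subtype.val (h i)) ⟨x, hi⟩
  glue {ι U} V hV hc s h := by
    choose i hi using hc
    have hs : ∀ (x : EuclideanSpace ℝ (Fin p)) (hx : x ∈ U) (j : ι) (hj : x ∈ V j),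
        (s (i x hx)).1 ⟨x, hi x hx⟩ = (s j).1 ⟨x, hj⟩ := fun x hx j hj =>
      congrFun (congrArg Subtype.val (h (i x hx) j)) ⟨x, hi x hx, hj⟩
    refine ⟨⟨fun x => (s (i x.1 x.2)).1 ⟨x.1, hi x.1 x.2⟩, mem_smoothGrassmann.2 fun φ => ?_⟩,
      fun j => ?_⟩
    · rintro ⟨x, hx⟩
      have hj := hi x hx
      generalize i x hx = j at hj
      -- compare with the section `s j` near `x`, through the extension by zero
      let F : EuclideanSpace ℝ (Fin p) → ℝ :=
        Function.extend Subtype.val (fun y : U => φ ((s (i y.1 y.2)).1 ⟨y.1, hi y.1 y.2⟩)) 0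
      have hF : ∀ y : U, F y = φ ((s (i y.1 y.2)).1 ⟨y.1, hi y.1 y.2⟩) := fun y =>
        Subtype.val_injective.extend_apply _ _ y
      have hFj : ∀ y : V j, F y = φ ((s j).1 y) := fun y => by
        rw [hF ⟨y.1, hV j y.2⟩, hs y.1 (hV j y.2) j y.2]
      have h1 := mem_smoothGrassmann.1 (s j).2 φ ⟨x, hj⟩
      rw [← funext hFj, contMDiffAt_subtype_iff] at h1
      rw [← funext hF, contMDiffAt_subtype_iff]
      exact h1
    · ext ⟨x, hx⟩
      exact hs x (hV j hx) j hx

/-! ## Supermanifolds -/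

/-- A supermanifold: a superspace whose underlying space is Hausdorff and second countable, and
which is locally isomorphic to open subspaces of the superspaces `ℝ^{p|q}`. -/
def IsSupermanifold : ObjectProperty Superspace := fun X =>
  T2Space X.pt ∧ SecondCountableTopology X.pt ∧
    ∀ x : X.pt, ∃ (U : Opens X.pt) (p q : ℕ) (V : Opens (superEuclidean p q).pt),
      x ∈ U ∧ Nonempty (X.restrict U ≅ (superEuclidean p q).restrict V)

/-- The category of supermanifolds. -/
abbrev SM : Type 1 := IsSupermanifold.FullSubcategory

theorem isSupermanifold_superEuclidean (p q : ℕ) : IsSupermanifold (superEuclidean p q) :=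
  ⟨inferInstanceAs (T2Space (EuclideanSpace ℝ (Fin p))),
    inferInstanceAs (SecondCountableTopology (EuclideanSpace ℝ (Fin p))),
    fun _ => ⟨⊤, p, q, ⊤, trivial, ⟨Iso.refl _⟩⟩⟩

/-- The supermanifold `ℝ^{0|n}`. -/
def oddSpace (n : ℕ) : SM := ⟨superEuclidean 0 n, isSupermanifold_superEuclidean 0 n⟩

namespace Superspace

/-- The real number `c` is the value of the section `s` at the point `x`: the section `s - c` is
not invertible in any neighbourhood of `x`. On a supermanifold each section has exactly one value
at each point of its domain. -/
def HasValueAt (X : Superspace) {U : Opens X.pt} (s : X.sec U) (x : X.pt) (c : ℝ) : Prop :=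
  ¬ X.InvertibleAt (s - algebraMap ℝ (X.sec U) c) x

/-- A tangent vector at `x` (the sum of an even one and an odd one): a derivation from the stalk
at `x` to `ℝ`, given as a compatible family of derivations on the sections over the neighbourhoods
of `x`. The sign of the graded Leibniz rule plays no role, since odd sections have value zero. -/
structure TangentVector (X : Superspace) (x : X.pt) where
  toFun : ∀ U : Opens X.pt, x ∈ U → X.sec U →ₗ[ℝ] ℝ
  toFun_res : ∀ {U V : Opens X.pt} (h : U ≤ V) (hx : x ∈ U) (s : X.sec V),
    toFun U hx (X.res h s) = toFun V (h hx) s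
  leibniz : ∀ (U : Opens X.pt) (hx : x ∈ U) (a b : X.sec U) (c d : ℝ),
    X.HasValueAt a x c → X.HasValueAt b x d →
      toFun U hx (a * b) = c * toFun U hx b + d * toFun U hx a

/-- Submersions: the differential `v ↦ (s ↦ v (f^* s))`, from the tangent space at `x` to the
tangent space at `f x`, is surjective for each `x`. -/
def IsSubmersion {X Y : Superspace} (f : X ⟶ Y) : Prop :=
  ∀ (x : X.pt) (w : Y.TangentVector (f.base x)), ∃ v : X.TangentVector x,
    ∀ (V : Opens Y.pt) (hx : f.base x ∈ V) (s : Y.sec V),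
      w.toFun V hx s = v.toFun (Opens.comap f.base V) hx (f.app V s)

end Superspace

/-! ## Surjective submersions and the categories `SSM` and `SSM_n` -/

/-- The arrows of the category of supermanifolds that are surjective submersions. -/
def IsSurjectiveSubmersion : ObjectProperty (Arrow SM) := fun a =>
  Function.Surjective a.hom.hom.base ∧ Superspace.IsSubmersion a.hom.hom

/-- The category of surjective submersions; the morphisms are the commutative squares. -/
abbrev SSM : Type 1 := IsSurjectiveSubmersion.FullSubcategory

/-- The surjective submersions of the form `ℝ^{0|n} × N → N`, the arrow being the canonical
projection: `f : M → N` is the second projection of a cartesian product of `ℝ^{0|n}` and `N` in the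
category of supermanifolds. -/
def IsOddProjection (n : ℕ) : ObjectProperty SSM := fun a =>
  ∃ p : a.obj.left ⟶ oddSpace n, Nonempty (Limits.IsLimit (Limits.BinaryFan.mk p a.obj.hom))

/-- The full subcategory of `SSM` on the surjective submersions `ℝ^{0|n} × N → N`. -/
abbrev SSMn (n : ℕ) : Type 1 := (IsOddProjection n).FullSubcategory

namespace SSMn

/-- The total space `M ≅ ℝ^{0|n} × N` of an object `M → N`. -/
abbrev total {n : ℕ} (P : SSMn n) : SM := P.obj.obj.left

/-- The base `N` of an object `M → N`. -/
abbrev base {n : ℕ} (P : SSMn n) : SM := P.obj.obj.right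

/-- The projection `M → N`. -/
abbrev proj {n : ℕ} (P : SSMn n) : P.total ⟶ P.base := P.obj.obj.hom

/-- The other projection, `M → ℝ^{0|n}`. -/
noncomputable def coord {n : ℕ} (P : SSMn n) : P.total ⟶ oddSpace n := P.property.choose

/-- The two projections make `M` a product of `ℝ^{0|n}` and `N`. -/
noncomputable def isLimit {n : ℕ} (P : SSMn n) :
    Limits.IsLimit (Limits.BinaryFan.mk P.coord P.proj) :=
  P.property.choose_spec.some

/-- The morphism to `M` with given components in `ℝ^{0|n}` and `N`. -/
noncomputable def pair {n : ℕ} (P : SSMn n) {Y : SM} (u : Y ⟶ oddSpace n) (y : Y ⟶ P.base) :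
    Y ⟶ P.total :=
  P.isLimit.lift (Limits.BinaryFan.mk u y)

theorem pair_coord {n : ℕ} (P : SSMn n) {Y : SM} (u : Y ⟶ oddSpace n) (y : Y ⟶ P.base) :
    P.pair u y ≫ P.coord = u :=
  P.isLimit.fac (Limits.BinaryFan.mk u y) ⟨Limits.WalkingPair.left⟩

theorem pair_proj {n : ℕ} (P : SSMn n) {Y : SM} (u : Y ⟶ oddSpace n) (y : Y ⟶ P.base) :
    P.pair u y ≫ P.proj = y :=
  P.isLimit.fac (Limits.BinaryFan.mk u y) ⟨Limits.WalkingPair.right⟩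

theorem pair_unique {n : ℕ} (P : SSMn n) {Y : SM} {u : Y ⟶ oddSpace n} {y : Y ⟶ P.base}
    {m : Y ⟶ P.total} (hu : m ≫ P.coord = u) (hy : m ≫ P.proj = y) : m = P.pair u y :=
  Limits.BinaryFan.IsLimit.hom_ext P.isLimit
    (hu.trans (P.pair_coord u y).symm) (hy.trans (P.pair_proj u y).symm)

/-- The morphism of total spaces underlying a morphism of `SSM_n`. -/
abbrev onTotal {n : ℕ} {P Q : SSMn n} (h : P ⟶ Q) : P.total ⟶ Q.total := h.hom.hom.left

/-- The morphism of bases underlying a morphism of `SSM_n`. -/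
abbrev onBase {n : ℕ} {P Q : SSMn n} (h : P ⟶ Q) : P.base ⟶ Q.base := h.hom.hom.right

end SSMn

/-! ## Presheaves with a right action of an internal endomorphism monoid -/

/-- The elements over `X` of the presheaf `𝐇𝐨𝐦(R, R)`, that is, morphisms of presheaves
`R × X → R`, where objects stand for the presheaves that they represent. If the product `R × X`
exists in `C` then, by the Yoneda lemma, these are the morphisms `R × X → R` of `C`. -/
@[ext]
structure InternalEnd {C : Type*} [Category C] (R X : C) where
  app : ∀ {Y : C}, (Y ⟶ R) → (Y ⟶ X) → (Y ⟶ R)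
  naturality : ∀ {Y' Y : C} (h : Y' ⟶ Y) (u : Y ⟶ R) (x : Y ⟶ X),
    app (h ≫ u) (h ≫ x) = h ≫ app u x

namespace InternalEnd

/-- The elements over `X` form a monoid under composition, `(φ ψ)(u, x) = φ(ψ(u, x), x)`. -/
instance {C : Type*} [Category C] (R X : C) : Monoid (InternalEnd R X) where
  one := ⟨fun u _ => u, fun _ _ _ => rfl⟩
  mul φ ψ := ⟨fun u x => φ.app (ψ.app u x) x, fun h u x => by
    rw [ψ.naturality, φ.naturality]⟩
  one_mul _ := rfl
  mul_one _ := rfl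
  mul_assoc _ _ _ := rfl

/-- The functoriality of the presheaf `𝐇𝐨𝐦(R, R)`. -/
def pull {C : Type*} [Category C] {R X X' : C} (g : X' ⟶ X) (φ : InternalEnd R X) :
    InternalEnd R X' where
  app u x := φ.app u (x ≫ g)
  naturality h u x := by rw [Category.assoc, φ.naturality]

end InternalEnd

universe w

/-- A presheaf `psh` on `C` with a right action `psh × 𝐇𝐨𝐦(R, R) → psh` of the presheaf of monoids
`𝐇𝐨𝐦(R, R)`. -/
structure EquivariantPresheaf {C : Type*} [Category C] (R : C) where
  psh : Cᵒᵖ ⥤ Type w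
  act : ∀ {X : C}, psh.obj (op X) → InternalEnd R X → psh.obj (op X)
  act_one : ∀ {X : C} (a : psh.obj (op X)), act a 1 = a
  act_mul : ∀ {X : C} (a : psh.obj (op X)) (φ ψ : InternalEnd R X),
    act a (φ * ψ) = act (act a φ) ψ
  map_act : ∀ {X' X : C} (g : X' ⟶ X) (a : psh.obj (op X)) (φ : InternalEnd R X),
    psh.map g.op (act a φ) = act (psh.map g.op a) (φ.pull g)

namespace EquivariantPresheaf

/-- A morphism of presheaves that commutes with the actions. -/
@[ext]
structure Hom {C : Type*} [Category C] {R : C} (F G : EquivariantPresheaf.{w} R) where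
  nat : F.psh ⟶ G.psh
  map_act : ∀ {X : C} (a : F.psh.obj (op X)) (φ : InternalEnd R X),
    nat.app (op X) (F.act a φ) = G.act (nat.app (op X) a) φ

instance {C : Type*} [Category C] (R : C) : Category (EquivariantPresheaf.{w} R) where
  Hom := Hom
  id F := ⟨𝟙 F.psh, fun _ _ => rfl⟩
  comp f g := ⟨f.nat ≫ g.nat, fun a φ => by
    simp [f.map_act, g.map_act]⟩

end EquivariantPresheaf

/-! ## The comparison of the two categories of presheaves -/

namespace SSMn

/-- The `ℝ^{0|n}`-component of a morphism `h` from `ℝ^{0|n} × N₁ → N₁` to `ℝ^{0|n} × N₂ → N₂`, an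
element of `𝐇𝐨𝐦(ℝ^{0|n}, ℝ^{0|n})` over `N₁`. -/
noncomputable def fibre {n : ℕ} {P Q : SSMn n} (h : P ⟶ Q) :
    InternalEnd (oddSpace n) P.base where
  app u y := P.pair u y ≫ onTotal h ≫ Q.coord
  naturality k u y := by
    have : P.pair (k ≫ u) (k ≫ y) = k ≫ P.pair u y :=
      (P.pair_unique (by rw [Category.assoc, pair_coord])
        (by rw [Category.assoc, pair_proj])).symm
    rw [this, Category.assoc]

theorem fibre_id {n : ℕ} (P : SSMn n) : fibre (𝟙 P) = 1 := by
  refine InternalEnd.ext ?_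
  funext Y u y
  exact congrArg _ (Category.id_comp _) |>.trans (P.pair_coord u y)

theorem fibre_comp {n : ℕ} {P Q S : SSMn n} (h : P ⟶ Q) (k : Q ⟶ S) :
    fibre (h ≫ k) = (fibre k).pull (onBase h) * fibre h := by
  refine InternalEnd.ext ?_
  funext Y u y
  have hk : P.pair u y ≫ onTotal h = Q.pair ((fibre h).app u y) (y ≫ onBase h) := by
    refine Q.pair_unique ?_ ?_
    · exact Category.assoc _ _ _
    · have w : onTotal h ≫ Q.proj = P.proj ≫ onBase h := Arrow.w h.hom.hom
      rw [Category.assoc, w, ← Category.assoc, pair_proj]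
  change P.pair u y ≫ (onTotal h ≫ onTotal k) ≫ S.coord =
    Q.pair ((fibre h).app u y) (y ≫ onBase h) ≫ onTotal k ≫ S.coord
  rw [← hk]
  simp only [Category.assoc]

/-- The presheaf on `SSM_n` defined by a presheaf `G` on supermanifolds with a right action of
`𝐇𝐨𝐦(ℝ^{0|n}, ℝ^{0|n})`. Its value on `ℝ^{0|n} × N → N` is `G(N)`, and a morphism `h`, given by
`g : N₁ → N₂` and `φ ∈ 𝐇𝐨𝐦(ℝ^{0|n}, ℝ^{0|n})(N₁)`, acts by `a ↦ (g^* a) · φ`. -/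
noncomputable def presheafOf {n : ℕ} (G : EquivariantPresheaf.{w} (oddSpace n)) :
    (SSMn n)ᵒᵖ ⥤ Type w where
  obj P := G.psh.obj (op P.unop.base)
  map h := ↾fun a => G.act (G.psh.map (onBase h.unop).op a) (fibre h.unop)
  map_id P := by
    ext a
    change G.act (G.psh.map (𝟙 _) a) (fibre (𝟙 P.unop)) = a
    rw [fibre_id, G.act_one]
    simp
  map_comp {P Q S} h k := by
    ext a
    change G.act (G.psh.map (onBase k.unop ≫ onBase h.unop).op a) (fibre (k.unop ≫ h.unop)) =
      G.act (G.psh.map (onBase k.unop).op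
        (G.act (G.psh.map (onBase h.unop).op a) (fibre h.unop))) (fibre k.unop)
    rw [fibre_comp, G.act_mul, G.map_act]
    simp

/-- The comparison functor, from presheaves on supermanifolds with a right action of
`𝐇𝐨𝐦(ℝ^{0|n}, ℝ^{0|n})` to presheaves on `SSM_n`. -/
noncomputable def comparison (n : ℕ) :
    EquivariantPresheaf.{w} (oddSpace n) ⥤ ((SSMn n)ᵒᵖ ⥤ Type w) where
  obj G := presheafOf G
  map {F G} t :=
    { app := fun P => t.nat.app (op P.unop.base)
      naturality := fun P Q h => by
        ext a
        change t.nat.app _ (F.act (F.psh.map (onBase h.unop).op a) (fibre h.unop)) =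
          G.act (G.psh.map (onBase h.unop).op (t.nat.app _ a)) (fibre h.unop)
        rw [t.map_act]
        congr 1
        exact NatTrans.naturality_apply t.nat _ a }
  map_id _ := rfl
  map_comp _ _ := rfl

end SSMn

/-! The equivalence itself is formal. By the universal property of the product, a morphism of `SSMn
n` is the same as a pair `(g, φ)` of a morphism `g` of bases and an element `φ` of the internal
endomorphism monoid over the source base (`hom_ext'`, `mkHom`). The composite of `(g, φ)` followed
by `(k, ψ)` is `(g ≫ k, ψ.pull g * φ)`, as in a semidirect product (`mkHom_comp`). Up to
isomorphism, every morphism factors as a vertical one `(𝟙, φ)` followed by a cartesian one `(g, 1)`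
(`toStd_stdHom`). A presheaf on `SSMn n` is therefore a presheaf on `SM`, given by the cartesian
morphisms, with a right action, given by the vertical ones. The rule for interchanging the two kinds
says that the action is a morphism of presheaves.

The geometric content is that every `N` is the base of some object: the product `ℝ^{0|n} × N` must
exist in `SM`, and its projection must be a surjective submersion. The product is
`Superspace.thicken`: the space of `N` with the graded tensor product of its structure sheaf and a
Grassmann algebra `Λ`. Four facts make this work.

Since `Λ` has a finite basis, sections are finite families of coefficients, and the sheaf axioms
hold coefficientwise.

A section differs from its body, obtained by setting the odd coordinates to zero, by an element of
an ideal of nilpotents. Units are thus detected on bodies (`isUnit_body_iff`), which gives the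
locality conditions.

A morphism from `Y` to `ℝ^{0|n} × X` is a morphism to `X` together with a graded homomorphism from
`Λ` to the global sections of `Y` (`thickenLift`, `thicken_hom_ext`). If `Y` is a supermanifold,
such homomorphisms are also the morphisms from `Y` to `ℝ^{0|n}` (`homOfAlgHom`,
`superEuclidean.hom_ext`). This is the universal property of the product.

The tensor product of the Grassmann algebras on `q` and on `n` generators is the one on `q + n`
generators, so charts in `ℝ^{p|q}` become charts in `ℝ^{p|q+n}`. Composition with the body lifts
tangent vectors along the projection. -/

/-! ## Supercommutative algebras -/

/-- A `ℤ/2`-grading of an algebra for which homogeneous elements commute up to the usual sign. -/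
def Supercommutative {A : Type*} [Ring A] [Algebra ℝ A] (𝒜 : ZMod 2 → Submodule ℝ A) : Prop :=
  ∀ ⦃i j : ZMod 2⦄ ⦃a b : A⦄, a ∈ 𝒜 i → b ∈ 𝒜 j → a * b = (-1 : ℤˣ) ^ (i * j) • (b * a)

section Grading

variable {A : Type*} [Ring A] [Algebra ℝ A] {𝒜 : ZMod 2 → Submodule ℝ A}

theorem isCompl_even_odd [DirectSum.Decomposition 𝒜] : IsCompl (𝒜 0) (𝒜 1) :=
  (DirectSum.isInternal_submodule_iff_isCompl 𝒜 (i := 0) (j := 1) (by decide)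
    (by ext i; revert i; simp; decide)).1 (DirectSum.Decomposition.isInternal 𝒜)

theorem exists_even_add_odd [DirectSum.Decomposition 𝒜] (a : A) :
    ∃ a₀ ∈ 𝒜 0, ∃ a₁ ∈ 𝒜 1, a₀ + a₁ = a :=
  Submodule.mem_sup.1 (isCompl_even_odd (𝒜 := 𝒜).sup_eq_top ▸ Submodule.mem_top)

theorem isInternal_of_isCompl (h : IsCompl (𝒜 0) (𝒜 1)) : DirectSum.IsInternal 𝒜 :=
  (DirectSum.isInternal_submodule_iff_isCompl 𝒜 (i := 0) (j := 1) (by decide)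
    (by ext i; revert i; simp; decide)).2 h

/-- The existence of the parity involution of a `ℤ/2`-graded algebra. -/
theorem exists_parity (𝒜 : ZMod 2 → Submodule ℝ A) [DirectSum.Decomposition 𝒜] :
    ∃ α : A →ₗ[ℝ] A, ∀ (i : ZMod 2) (a : A), a ∈ 𝒜 i → α a = (-1 : ℤˣ) ^ i • a := by
  have hc := isCompl_even_odd (𝒜 := 𝒜)
  refine ⟨Submodule.projection _ _ hc - Submodule.projection _ _ hc.symm, fun i a ha => ?_⟩
  obtain rfl | rfl : i = 0 ∨ i = 1 := by clear ha; revert i; decide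
  · simp [Submodule.projection_apply_of_mem_left hc ha,
      (Submodule.projection_apply_eq_zero_iff hc.symm).2 ha]
  · simp [Submodule.projection_apply_of_mem_left hc.symm ha,
      (Submodule.projection_apply_eq_zero_iff hc).2 ha]

/-! ### The nilradical of a supercommutative algebra. -/

namespace Supercommutative

theorem commute_of_even [DirectSum.Decomposition 𝒜] (h : Supercommutative 𝒜) {a : A}
    (ha : a ∈ 𝒜 0) (b : A) : Commute a b := by
  obtain ⟨b₀, h₀, b₁, h₁, rfl⟩ := exists_even_add_odd (𝒜 := 𝒜) b
  refine Commute.add_right ?_ ?_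
  · simpa [Commute, SemiconjBy] using h ha h₀
  · simpa [Commute, SemiconjBy] using h ha h₁

theorem mul_odd (h : Supercommutative 𝒜) {a b : A} (ha : a ∈ 𝒜 1) (hb : b ∈ 𝒜 1) :
    a * b = -(b * a) := by
  simpa using h ha hb

theorem sq_odd (h : Supercommutative 𝒜) {a : A} (ha : a ∈ 𝒜 1) : a * a = 0 := by
  have h1 : a * a = -(a * a) := h.mul_odd ha ha
  have h2 : (2 : ℝ) • (a * a) = 0 := by
    rw [two_smul]; nth_rewrite 1 [h1]; simp
  simpa using h2

/-- The nilradical: the sums of an even nilpotent element and an odd element. -/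
def nilradical [GradedAlgebra 𝒜] (h : Supercommutative 𝒜) : Ideal A where
  carrier := {t | ∃ a ∈ 𝒜 0, ∃ b ∈ 𝒜 1, IsNilpotent a ∧ a + b = t}
  zero_mem' := ⟨0, zero_mem _, 0, zero_mem _, IsNilpotent.zero, by simp⟩
  add_mem' := by
    rintro _ _ ⟨a, ha, b, hb, hn, rfl⟩ ⟨a', ha', b', hb', hn', rfl⟩
    exact ⟨a + a', add_mem ha ha', b + b', add_mem hb hb',
      (h.commute_of_even ha a').isNilpotent_add hn hn', by abel⟩
  smul_mem' := by
    rintro c _ ⟨a, ha, b, hb, hn, rfl⟩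
    obtain ⟨c₀, h₀, c₁, h₁, rfl⟩ := exists_even_add_odd (𝒜 := 𝒜) c
    have m00 : c₀ * a ∈ 𝒜 0 := SetLike.GradedMul.mul_mem h₀ ha
    have m11 : c₁ * b ∈ 𝒜 0 := SetLike.GradedMul.mul_mem h₁ hb
    have m10 : c₁ * a ∈ 𝒜 1 := SetLike.GradedMul.mul_mem h₁ ha
    have m01 : c₀ * b ∈ 𝒜 1 := by simpa using SetLike.GradedMul.mul_mem h₀ hb
    refine ⟨c₀ * a + c₁ * b, add_mem m00 m11, c₁ * a + c₀ * b, add_mem m10 m01, ?_, ?_⟩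
    -- The even part is nilpotent: `c₀ * a` because `c₀` commutes with the nilpotent `a`, and `c₁ *
    -- b` because moving `c₁` past `b` leaves a factor `b * b = 0` in its square.
    · refine (h.commute_of_even m00 _).isNilpotent_add
        ((h.commute_of_even h₀ a).isNilpotent_mul_left hn) ⟨2, ?_⟩
      rw [sq, mul_assoc, ← mul_assoc b, h.mul_odd hb h₁, neg_mul, mul_assoc, h.sq_odd hb]
      simp
    · simp only [smul_eq_mul]
      noncomm_ring

variable [GradedAlgebra 𝒜] (h : Supercommutative 𝒜)

theorem odd_mem_nilradical {b : A} (hb : b ∈ 𝒜 1) : b ∈ h.nilradical :=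
  ⟨0, zero_mem _, b, hb, IsNilpotent.zero, zero_add b⟩

theorem isNilpotent_of_mem {t : A} (ht : t ∈ h.nilradical) : IsNilpotent t := by
  obtain ⟨a, ha, b, hb, hn, rfl⟩ := ht
  exact (h.commute_of_even ha b).isNilpotent_add hn ⟨2, by rw [sq, h.sq_odd hb]⟩

/-- `Ideal` means left ideal here. Moving `c` to the left of the homogeneous parts of `t` costs only
signs, so the ideal is two-sided. -/
theorem mul_mem_nilradical_right {t : A} (ht : t ∈ h.nilradical) (c : A) :
    t * c ∈ h.nilradical := by
  obtain ⟨a, ha, b, hb, hn, rfl⟩ := ht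
  obtain ⟨c₀, h₀, c₁, h₁, rfl⟩ := exists_even_add_odd (𝒜 := 𝒜) c
  have e : (a + b) * (c₀ + c₁) = (c₀ + c₁) * a + (c₀ * b - c₁ * b) := by
    rw [(h.commute_of_even ha (c₀ + c₁)).symm.eq, (h.commute_of_even h₀ b).eq,
      ← neg_eq_iff_eq_neg.2 (h.mul_odd hb h₁)]
    noncomm_ring
  have ha' : a ∈ h.nilradical := ⟨a, ha, 0, zero_mem _, hn, add_zero a⟩
  have hb' := h.odd_mem_nilradical hb
  rw [e]
  exact add_mem (Ideal.mul_mem_left _ _ ha')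
    (sub_mem (Ideal.mul_mem_left _ _ hb') (Ideal.mul_mem_left _ _ hb'))

/-- Factor `u + t = u (1 + u⁻¹ t)`; the element `u⁻¹ t` stays in the ideal, hence is nilpotent. -/
theorem isUnit_add {u t : A} (hu : IsUnit u) (ht : t ∈ h.nilradical) : IsUnit (u + t) := by
  obtain ⟨u, rfl⟩ := hu
  have hn := h.isNilpotent_of_mem (Ideal.mul_mem_left _ (↑u⁻¹ : A) ht)
  have e : (u : A) + t = u * (1 + ↑u⁻¹ * t) := by
    rw [mul_add, mul_one, Units.mul_inv_cancel_left]
  rw [e]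
  exact u.isUnit.mul hn.isUnit_one_add

/-- A graded homomorphism maps the nilradical to the nilradical. -/
theorem map_mem_nilradical {B : Type*} [Ring B] [Algebra ℝ B] {ℬ : ZMod 2 → Submodule ℝ B}
    [GradedAlgebra ℬ] (k : Supercommutative ℬ) (f : A →ₐ[ℝ] B)
    (hf : ∀ i, ∀ a ∈ 𝒜 i, f a ∈ ℬ i) {t : A} (ht : t ∈ h.nilradical) : f t ∈ k.nilradical := by
  obtain ⟨a, ha, b, hb, hn, rfl⟩ := ht
  exact ⟨f a, hf 0 a ha, f b, hf 1 b hb, hn.map f, (map_add f a b).symm⟩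

end Supercommutative

end Grading

/-! ## The graded tensor product of superalgebras -/

namespace GradedTensorProduct

section

variable {A B : Type*} [Ring A] [Algebra ℝ A] [Ring B] [Algebra ℝ B]
  (𝒜 : ZMod 2 → Submodule ℝ A) (ℬ : ZMod 2 → Submodule ℝ B) [GradedAlgebra 𝒜] [GradedAlgebra ℬ]

/-- The total grading of a graded tensor product. -/
noncomputable def totalGr (k : ZMod 2) : Submodule ℝ (GradedTensorProduct ℝ 𝒜 ℬ) :=
  Submodule.span ℝ {t | ∃ i j : ZMod 2, ∃ a ∈ 𝒜 i, ∃ b ∈ ℬ j, i + j = k ∧ t = a ᵍ⊗ₜ b}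

variable {𝒜 ℬ}

theorem tmul_mem_totalGr {i j : ZMod 2} {a : A} {b : B} (ha : a ∈ 𝒜 i) (hb : b ∈ ℬ j) :
    (a ᵍ⊗ₜ b : GradedTensorProduct ℝ 𝒜 ℬ) ∈ totalGr 𝒜 ℬ (i + j) :=
  Submodule.subset_span ⟨i, j, a, ha, b, hb, rfl, rfl⟩

theorem units_smul_tmul (u : ℤˣ) (a : A) (b : B) :
    ((u • a) ᵍ⊗ₜ b : GradedTensorProduct ℝ 𝒜 ℬ) = u • (a ᵍ⊗ₜ b) := by
  rcases Int.units_eq_one_or u with rfl | rfl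
  · simp
  · rw [Units.neg_smul, one_smul, Units.neg_smul, one_smul, tmul, TensorProduct.neg_tmul, map_neg]

theorem tmul_units_smul (u : ℤˣ) (a : A) (b : B) :
    (a ᵍ⊗ₜ (u • b) : GradedTensorProduct ℝ 𝒜 ℬ) = u • (a ᵍ⊗ₜ b) := by
  rcases Int.units_eq_one_or u with rfl | rfl
  · simp
  · rw [Units.neg_smul, one_smul, Units.neg_smul, one_smul, tmul, TensorProduct.tmul_neg, map_neg]

theorem tmul_mul_tmul {i j : ZMod 2} {a a' : A} {b b' : B} (hb : b ∈ ℬ j) (ha : a' ∈ 𝒜 i) :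
    (a ᵍ⊗ₜ b * a' ᵍ⊗ₜ b' : GradedTensorProduct ℝ 𝒜 ℬ) =
      (-1 : ℤˣ) ^ (j * i) • ((a * a') ᵍ⊗ₜ (b * b')) :=
  tmul_coe_mul_coe_tmul 𝒜 ℬ a ⟨b, hb⟩ ⟨a', ha⟩ b'

theorem units_smul_mem {M : Type*} [AddCommGroup M] [Module ℝ M] (S : Submodule ℝ M) (u : ℤˣ)
    {x : M} (hx : x ∈ S) : u • x ∈ S := by
  rcases Int.units_eq_one_or u with rfl | rfl
  · simpa using hx
  · simpa using hx

instance totalGr_gradedMonoid : SetLike.GradedMonoid (totalGr 𝒜 ℬ) where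
  one_mem := by
    have := tmul_mem_totalGr (𝒜 := 𝒜) (ℬ := ℬ) (SetLike.GradedOne.one_mem (A := 𝒜))
      (SetLike.GradedOne.one_mem (A := ℬ))
    rwa [add_zero] at this
  mul_mem k l s t hs ht := by
    induction hs, ht using Submodule.span_induction₂ with
    | mem_mem s t hs ht =>
      obtain ⟨i, j, a, ha, b, hb, rfl, rfl⟩ := hs
      obtain ⟨i', j', a', ha', b', hb', rfl, rfl⟩ := ht
      rw [tmul_mul_tmul hb ha', add_add_add_comm]
      exact units_smul_mem _ _ (tmul_mem_totalGr (SetLike.GradedMul.mul_mem ha ha')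
        (SetLike.GradedMul.mul_mem hb hb'))
    | zero_left _ _ => rw [zero_mul]; exact zero_mem _
    | zero_right _ _ => rw [mul_zero]; exact zero_mem _
    | add_left _ _ _ _ _ _ h1 h2 => rw [add_mul]; exact add_mem h1 h2
    | add_right _ _ _ _ _ _ h1 h2 => rw [mul_add]; exact add_mem h1 h2
    | smul_left r _ _ _ _ h1 => rw [smul_mul_assoc]; exact Submodule.smul_mem _ _ h1
    | smul_right r _ _ _ _ h1 => rw [mul_smul_comm]; exact Submodule.smul_mem _ _ h1

theorem totalGr_supercommutative (hA : Supercommutative 𝒜) (hB : Supercommutative ℬ) :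
    Supercommutative (totalGr 𝒜 ℬ) := by
  intro k l s t hs ht
  induction hs, ht using Submodule.span_induction₂ with
  | mem_mem s t hs ht =>
    obtain ⟨i, j, a, ha, b, hb, rfl, rfl⟩ := hs
    obtain ⟨i', j', a', ha', b', hb', rfl, rfl⟩ := ht
    rw [tmul_mul_tmul hb ha', tmul_mul_tmul hb' ha, hA ha ha', hB hb hb', units_smul_tmul,
      tmul_units_smul, smul_smul, smul_smul, smul_smul]
    -- Both sides are the same tensor with different products of Koszul signs; comparing the signs
    -- is a finite check on the four parities.
    congr 1
    clear ha hb ha' hb'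
    revert i j i' j'
    decide
  | zero_left _ _ => simp
  | zero_right _ _ => simp
  | add_left _ _ _ _ _ _ h1 h2 => rw [add_mul, mul_add, h1, h2, smul_add]
  | add_right _ _ _ _ _ _ h1 h2 => rw [add_mul, mul_add, h1, h2, smul_add]
  | smul_left r _ _ _ _ h1 => rw [smul_mul_assoc, mul_smul_comm, h1, smul_comm]
  | smul_right r _ _ _ _ h1 => rw [smul_mul_assoc, mul_smul_comm, h1, smul_comm]

theorem induction_tmul {p : GradedTensorProduct ℝ 𝒜 ℬ → Prop} (zero : p 0)
    (tmul : ∀ a b, p (a ᵍ⊗ₜ b)) (add : ∀ s t, p s → p t → p (s + t))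
    (t : GradedTensorProduct ℝ 𝒜 ℬ) : p t :=
  TensorProduct.induction_on (motive := p) t zero tmul add

/-- The tensor product of the two parity involutions acts on degree `k` by `(-1)^k`. An element of
both degrees equals its own negative, hence vanishes. The two degrees span because every pure tensor
is a sum of homogeneous ones. -/
theorem totalGr_isInternal : DirectSum.IsInternal (totalGr 𝒜 ℬ) := by
  apply isInternal_of_isCompl
  constructor
  · obtain ⟨α, hα⟩ := exists_parity 𝒜
    obtain ⟨β, hβ⟩ := exists_parity ℬ
    let P : GradedTensorProduct ℝ 𝒜 ℬ →ₗ[ℝ] GradedTensorProduct ℝ 𝒜 ℬ :=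
      (of ℝ 𝒜 ℬ).toLinearMap ∘ₗ TensorProduct.map α β ∘ₗ (of ℝ 𝒜 ℬ).symm.toLinearMap
    have hP : ∀ (k : ZMod 2) (t), t ∈ totalGr 𝒜 ℬ k → P t = (-1 : ℤˣ) ^ k • t := by
      intro k t ht
      induction ht using Submodule.span_induction with
      | mem t ht =>
        obtain ⟨i, j, a, ha, b, hb, rfl, rfl⟩ := ht
        change (α a ᵍ⊗ₜ β b : GradedTensorProduct ℝ 𝒜 ℬ) = _
        rw [hα i a ha, hβ j b hb, units_smul_tmul, tmul_units_smul, smul_smul, uzpow_add]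
      | zero => simp
      | add _ _ _ _ h1 h2 => rw [map_add, h1, h2, smul_add]
      | smul r _ _ h1 => rw [map_smul, h1, smul_comm]
    rw [Submodule.disjoint_def]
    intro t h0 h1
    have e0 := hP 0 t h0
    have e1 := hP 1 t h1
    rw [uzpow_zero, one_smul] at e0
    rw [uzpow_one, e0] at e1
    have e2 : (2 : ℝ) • t = 0 := by
      rw [two_smul]; nth_rewrite 1 [e1]; simp
    simpa using e2
  · rw [codisjoint_iff, eq_top_iff]
    rintro t -
    induction t using induction_tmul with
    | zero => exact zero_mem _
    | add s t hs ht => exact add_mem hs ht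
    | tmul a b =>
      have key : ∀ i j : ZMod 2, ∀ a ∈ 𝒜 i, ∀ b ∈ ℬ j,
          (a ᵍ⊗ₜ b : GradedTensorProduct ℝ 𝒜 ℬ) ∈ totalGr 𝒜 ℬ 0 ⊔ totalGr 𝒜 ℬ 1 := by
        intro i j a ha b hb
        have hm := tmul_mem_totalGr (𝒜 := 𝒜) (ℬ := ℬ) ha hb
        generalize i + j = k at hm
        fin_cases k
        · exact Submodule.mem_sup_left hm
        · exact Submodule.mem_sup_right hm
      obtain ⟨a₀, h₀, a₁, h₁, rfl⟩ := exists_even_add_odd (𝒜 := 𝒜) a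
      obtain ⟨b₀, k₀, b₁, k₁, rfl⟩ := exists_even_add_odd (𝒜 := ℬ) b
      simp only [tmul, TensorProduct.add_tmul, TensorProduct.tmul_add, map_add]
      exact add_mem (add_mem (key _ _ _ h₀ _ k₀) (key _ _ _ h₁ _ k₀))
        (add_mem (key _ _ _ h₀ _ k₁) (key _ _ _ h₁ _ k₁))

noncomputable instance totalGr_gradedAlgebra : GradedAlgebra (totalGr 𝒜 ℬ) :=
  { totalGr_gradedMonoid, totalGr_isInternal.chooseDecomposition with }

variable {C : Type*} [Ring C] [Algebra ℝ C] {𝒞 : ZMod 2 → Submodule ℝ C}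

/-- The homomorphism from a graded tensor product to a supercommutative algebra with given
components. -/
noncomputable def superLift (hC : Supercommutative 𝒞) (f : A →ₐ[ℝ] C) (g : B →ₐ[ℝ] C)
    (hf : ∀ i, ∀ a ∈ 𝒜 i, f a ∈ 𝒞 i) (hg : ∀ i, ∀ b ∈ ℬ i, g b ∈ 𝒞 i) :
    GradedTensorProduct ℝ 𝒜 ℬ →ₐ[ℝ] C :=
  lift 𝒜 ℬ f g fun i j a b => by
    rw [mul_comm j i]; exact hC (hf i a a.2) (hg j b b.2)

theorem superLift_tmul (hC : Supercommutative 𝒞) (f : A →ₐ[ℝ] C) (g : B →ₐ[ℝ] C)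
    (hf : ∀ i, ∀ a ∈ 𝒜 i, f a ∈ 𝒞 i) (hg : ∀ i, ∀ b ∈ ℬ i, g b ∈ 𝒞 i) (a : A) (b : B) :
    superLift hC f g hf hg (a ᵍ⊗ₜ b) = f a * g b :=
  lift_tmul _ _ _ _ _ _ _

theorem superLift_mem [SetLike.GradedMonoid 𝒞] (hC : Supercommutative 𝒞) (f : A →ₐ[ℝ] C)
    (g : B →ₐ[ℝ] C) (hf : ∀ i, ∀ a ∈ 𝒜 i, f a ∈ 𝒞 i) (hg : ∀ i, ∀ b ∈ ℬ i, g b ∈ 𝒞 i)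
    (k : ZMod 2) (t : GradedTensorProduct ℝ 𝒜 ℬ) (ht : t ∈ totalGr 𝒜 ℬ k) :
    superLift hC f g hf hg t ∈ 𝒞 k := by
  induction ht using Submodule.span_induction with
  | mem t ht =>
    obtain ⟨i, j, a, ha, b, hb, rfl, rfl⟩ := ht
    rw [superLift_tmul]
    exact SetLike.GradedMul.mul_mem (hf i a ha) (hg j b hb)
  | zero => rw [map_zero]; exact zero_mem _
  | add _ _ _ _ h1 h2 => rw [map_add]; exact add_mem h1 h2
  | smul r _ _ h1 => rw [map_smul]; exact Submodule.smul_mem _ _ h1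

theorem superAlgHom_ext {f g : GradedTensorProduct ℝ 𝒜 ℬ →ₐ[ℝ] C}
    (hl : ∀ a : A, f (a ᵍ⊗ₜ 1) = g (a ᵍ⊗ₜ 1)) (hr : ∀ b : B, f (1 ᵍ⊗ₜ b) = g (1 ᵍ⊗ₜ b)) :
    f = g :=
  algHom_ext 𝒜 ℬ (AlgHom.ext hl) (AlgHom.ext hr)

theorem includeLeft_mem (i : ZMod 2) (a : A) (ha : a ∈ 𝒜 i) :
    includeLeft 𝒜 ℬ a ∈ totalGr 𝒜 ℬ i := by
  have := tmul_mem_totalGr (𝒜 := 𝒜) (ℬ := ℬ) ha SetLike.GradedOne.one_mem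
  rwa [add_zero] at this

theorem includeRight_mem (i : ZMod 2) (b : B) (hb : b ∈ ℬ i) :
    includeRight 𝒜 ℬ b ∈ totalGr 𝒜 ℬ i := by
  have := tmul_mem_totalGr (𝒜 := 𝒜) (ℬ := ℬ) SetLike.GradedOne.one_mem hb
  rwa [zero_add] at this

/-- The functoriality of the graded tensor product in its first factor. -/
noncomputable def mapLeft {A' : Type*} [Ring A'] [Algebra ℝ A']
    {𝒜' : ZMod 2 → Submodule ℝ A'} [GradedAlgebra 𝒜'] (hA : Supercommutative 𝒜')
    (hB : Supercommutative ℬ) (f : A →ₐ[ℝ] A') (hf : ∀ i, ∀ a ∈ 𝒜 i, f a ∈ 𝒜' i) :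
    GradedTensorProduct ℝ 𝒜 ℬ →ₐ[ℝ] GradedTensorProduct ℝ 𝒜' ℬ :=
  superLift (totalGr_supercommutative hA hB) ((includeLeft 𝒜' ℬ).comp f) (includeRight 𝒜' ℬ)
    (fun i a ha => includeLeft_mem i (f a) (hf i a ha)) includeRight_mem

section

variable {A' : Type*} [Ring A'] [Algebra ℝ A'] {𝒜' : ZMod 2 → Submodule ℝ A'} [GradedAlgebra 𝒜']
  (hA : Supercommutative 𝒜') (hB : Supercommutative ℬ) (f : A →ₐ[ℝ] A')
  (hf : ∀ i, ∀ a ∈ 𝒜 i, f a ∈ 𝒜' i)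

theorem mapLeft_tmul (a : A) (b : B) : mapLeft hA hB f hf (a ᵍ⊗ₜ b) = f a ᵍ⊗ₜ b :=
  (superLift_tmul _ _ _ _ _ a b).trans (tmul_one_mul_one_tmul 𝒜' ℬ (f a) b)

theorem mapLeft_mem (k : ZMod 2) (t : GradedTensorProduct ℝ 𝒜 ℬ) (ht : t ∈ totalGr 𝒜 ℬ k) :
    mapLeft hA hB f hf t ∈ totalGr 𝒜' ℬ k :=
  superLift_mem (totalGr_supercommutative hA hB) _ _ _ _ k t ht

end

end

/-! ### Coefficients in a basis of the second factor. -/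

section Coeff

variable {A B ι : Type*} [Ring A] [Algebra ℝ A] [Ring B] [Algebra ℝ B]
  {𝒜 : ZMod 2 → Submodule ℝ A} {ℬ : ZMod 2 → Submodule ℝ B} [GradedAlgebra 𝒜] [GradedAlgebra ℬ]

/-- The coefficients of an element of a graded tensor product in a basis of the second factor. -/
noncomputable def coeff (b : Module.Basis ι ℝ B) (i : ι) : GradedTensorProduct ℝ 𝒜 ℬ →ₗ[ℝ] A :=
  (TensorProduct.rid ℝ A).toLinearMap ∘ₗ LinearMap.lTensor A (b.coord i) ∘ₗ
    (of ℝ 𝒜 ℬ).symm.toLinearMap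

theorem coeff_tmul (b : Module.Basis ι ℝ B) (i : ι) (x : A) (y : B) :
    coeff b i (x ᵍ⊗ₜ y : GradedTensorProduct ℝ 𝒜 ℬ) = b.repr y i • x :=
  rfl

theorem sum_coeff [Fintype ι] (b : Module.Basis ι ℝ B) (t : GradedTensorProduct ℝ 𝒜 ℬ) :
    ∑ i, (coeff b i t ᵍ⊗ₜ b i : GradedTensorProduct ℝ 𝒜 ℬ) = t := by
  induction t using induction_tmul with
  | zero => simp [tmul]
  | add s t hs ht =>
    conv_rhs => rw [← hs, ← ht]
    simp [tmul, TensorProduct.add_tmul, Finset.sum_add_distrib]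
  | tmul x y =>
    conv_rhs => rw [← b.sum_repr y]
    simp only [coeff_tmul, tmul, TensorProduct.tmul_sum, TensorProduct.smul_tmul, map_sum]

theorem coeff_ext [Fintype ι] (b : Module.Basis ι ℝ B) {s t : GradedTensorProduct ℝ 𝒜 ℬ}
    (h : ∀ i, coeff b i s = coeff b i t) : s = t := by
  rw [← sum_coeff b s, ← sum_coeff b t]
  simp only [h]

theorem coeff_sum [Fintype ι] (b : Module.Basis ι ℝ B) (x : ι → A) (i : ι) :
    coeff b i (∑ j, (x j ᵍ⊗ₜ b j : GradedTensorProduct ℝ 𝒜 ℬ)) = x i := by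
  classical
  simp [coeff_tmul, Finsupp.single_apply]

/-- A map of the first factor leaves the basis of the second alone. Applied to restriction maps,
this reduces the sheaf axioms of the product to those of the given superspace. -/
theorem coeff_mapLeft {A' : Type*} [Ring A'] [Algebra ℝ A']
    {𝒜' : ZMod 2 → Submodule ℝ A'} [GradedAlgebra 𝒜']
    (hA : Supercommutative 𝒜') (hB : Supercommutative ℬ) (f : A →ₐ[ℝ] A')
    (hf : ∀ i, ∀ a ∈ 𝒜 i, f a ∈ 𝒜' i) (b : Module.Basis ι ℝ B) (i : ι)
    (t : GradedTensorProduct ℝ 𝒜 ℬ) :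
    coeff b i (mapLeft hA hB f hf t) = f (coeff b i t) := by
  induction t using induction_tmul with
  | zero => simp
  | add s t hs ht => simp only [map_add, hs, ht]
  | tmul x y => rw [mapLeft_tmul, coeff_tmul, coeff_tmul, map_smul]

end Coeff

end GradedTensorProduct

/-! ## The body of a Grassmann algebra -/

namespace Grassmann

noncomputable instance (n : ℕ) : GradedAlgebra (gr n) :=
  CliffordAlgebra.gradedAlgebra (0 : QuadraticForm ℝ (Fin n → ℝ))

theorem supercommutative (n : ℕ) : Supercommutative (gr n) :=
  fun _ _ _ _ => supercomm

/-- The augmentation of the Grassmann algebra. -/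
noncomputable abbrev aug (n : ℕ) : Grassmann n →ₐ[ℝ] ℝ := ExteriorAlgebra.algebraMapInv

theorem ι_mem_gr {n : ℕ} (v : Fin n → ℝ) : ExteriorAlgebra.ι ℝ v ∈ gr n 1 :=
  CliffordAlgebra.ι_mem_evenOdd_one _ v

/-- An odd element squares to zero, and `ℝ` has no nonzero nilpotents. -/
theorem aug_odd {n : ℕ} {b : Grassmann n} (hb : b ∈ gr n 1) : aug n b = 0 := by
  have h := congrArg (aug n) ((supercommutative n).sq_odd hb)
  rw [map_mul, map_zero] at h
  exact mul_self_eq_zero.1 h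

/-- The generators are odd, hence in the nilradical, and products are handled by its being
two-sided. -/
theorem sub_aug_mem {n : ℕ} (b : Grassmann n) :
    b - algebraMap ℝ _ (aug n b) ∈ (supercommutative n).nilradical := by
  induction b using ExteriorAlgebra.induction with
  | algebraMap r => simp
  | ι v => simpa [aug, ExteriorAlgebra.algebraMapInv] using
      (supercommutative n).odd_mem_nilradical (ι_mem_gr v)
  | mul x y hx hy =>
    have e : x * y - algebraMap ℝ _ (aug n (x * y)) = (x - algebraMap ℝ _ (aug n x)) * y +
        algebraMap ℝ _ (aug n x) * (y - algebraMap ℝ _ (aug n y)) := by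
      rw [map_mul, map_mul]; noncomm_ring
    rw [e]
    exact add_mem (Supercommutative.mul_mem_nilradical_right _ hx _) (Ideal.mul_mem_left _ _ hy)
  | add x y hx hy =>
    have e : x + y - algebraMap ℝ _ (aug n (x + y)) = (x - algebraMap ℝ _ (aug n x)) +
        (y - algebraMap ℝ _ (aug n y)) := by
      rw [map_add, map_add]; abel
    rw [e]
    exact add_mem hx hy

theorem isUnit_of_aug_ne_zero {n : ℕ} {b : Grassmann n} (h : aug n b ≠ 0) : IsUnit b := by
  have := (supercommutative n).isUnit_add ((IsUnit.mk0 _ h).map (algebraMap ℝ (Grassmann n)))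
    (sub_aug_mem b)
  simpa using this

/-! ### The body map and the detection of units. -/

section Body

variable {A : Type*} [Ring A] [Algebra ℝ A] {𝒜 : ZMod 2 → Submodule ℝ A} [GradedAlgebra 𝒜]
  {n : ℕ}

/-- Setting the generators of the Grassmann algebra to zero. -/
noncomputable def body (hA : Supercommutative 𝒜) :
    GradedTensorProduct ℝ 𝒜 (gr n) →ₐ[ℝ] A :=
  GradedTensorProduct.superLift hA (AlgHom.id ℝ A) ((Algebra.ofId ℝ A).comp (aug n))
    (fun _ _ h => by rwa [AlgHom.id_apply]) fun i b hb => by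
      fin_cases i
      · exact SetLike.algebraMap_mem_graded 𝒜 _
      · simp only [AlgHom.comp_apply, aug_odd hb, map_zero]; exact zero_mem _

theorem body_tmul (hA : Supercommutative 𝒜) (a : A) (b : Grassmann n) :
    body hA (a ᵍ⊗ₜ b : GradedTensorProduct ℝ 𝒜 (gr n)) = aug n b • a := by
  rw [body, GradedTensorProduct.superLift_tmul, Algebra.smul_def, Algebra.commutes]
  rfl

/-- The nilradical of the graded tensor product with a Grassmann algebra. -/
noncomputable abbrev nil (hA : Supercommutative 𝒜) (n : ℕ) :=
  (GradedTensorProduct.totalGr_supercommutative hA (supercommutative n)).nilradical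

theorem sub_body_mem (hA : Supercommutative 𝒜) (t : GradedTensorProduct ℝ 𝒜 (gr n)) :
    t - (body hA t) ᵍ⊗ₜ 1 ∈ nil hA n := by
  induction t using GradedTensorProduct.induction_tmul with
  | zero => simp [GradedTensorProduct.tmul]
  | add s t hs ht =>
    rw [map_add]
    have := add_mem hs ht
    convert! this using 1
    simp only [GradedTensorProduct.tmul, TensorProduct.add_tmul, map_add]
    abel
  | tmul a b =>
    have h := (supercommutative n).map_mem_nilradical
      (GradedTensorProduct.totalGr_supercommutative hA (supercommutative n))
      (GradedTensorProduct.includeRight 𝒜 (gr n)) GradedTensorProduct.includeRight_mem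
      (sub_aug_mem b)
    convert! Ideal.mul_mem_left _ (GradedTensorProduct.includeLeft 𝒜 (gr n) a) h using 1
    rw [GradedTensorProduct.includeLeft_apply, GradedTensorProduct.includeRight_apply]
    refine Eq.trans ?_ (GradedTensorProduct.tmul_one_mul_one_tmul _ _ _ _).symm
    rw [body_tmul]
    simp only [GradedTensorProduct.tmul, TensorProduct.tmul_sub, map_sub,
      Algebra.algebraMap_eq_smul_one, TensorProduct.smul_tmul]

/-- If the body is a unit, so is its image in the tensor product, and `t` differs from that image by
an element of the nilradical. -/
theorem isUnit_body_iff (hA : Supercommutative 𝒜) (t : GradedTensorProduct ℝ 𝒜 (gr n)) :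
    IsUnit (body hA t) ↔ IsUnit t := by
  refine ⟨fun h => ?_, fun h => h.map _⟩
  have := (GradedTensorProduct.totalGr_supercommutative hA (supercommutative n)).isUnit_add
    (h.map (GradedTensorProduct.includeLeft 𝒜 (gr n))) (sub_body_mem hA t)
  rwa [GradedTensorProduct.includeLeft_apply, add_sub_cancel] at this

end Body

end Grassmann

/-! ## The product of a superspace with `ℝ^{0|n}` -/

namespace Superspace

section

variable (X : Superspace)

noncomputable instance (U : Opens X.pt) : GradedAlgebra (X.gr U) :=
  { X.gr_graded U, (X.gr_internal U).chooseDecomposition with }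

theorem supercommutative (U : Opens X.pt) : Supercommutative (X.gr U) :=
  fun _ _ _ _ => X.supercomm

/-- The sections of the structure sheaf of `ℝ^{0|n} × X`. -/
abbrev ThickSec (n : ℕ) (U : Opens X.pt) : Type :=
  GradedTensorProduct ℝ (X.gr U) (Grassmann.gr n)

/-- The restriction of sections of the structure sheaf of `ℝ^{0|n} × X`. -/
noncomputable def thickRes (n : ℕ) {U V : Opens X.pt} (h : U ≤ V) :
    X.ThickSec n V →ₐ[ℝ] X.ThickSec n U :=
  GradedTensorProduct.mapLeft (X.supercommutative U) (Grassmann.supercommutative n) (X.res h)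
    (X.res_gr h)

theorem thickRes_tmul (n : ℕ) {U V : Opens X.pt} (h : U ≤ V) (s : X.sec V) (b : Grassmann n) :
    X.thickRes n h (s ᵍ⊗ₜ b) = X.res h s ᵍ⊗ₜ b :=
  GradedTensorProduct.mapLeft_tmul _ _ _ _ s b

/-- The coefficients of a section of the structure sheaf of `ℝ^{0|n} × X`. -/
noncomputable abbrev thickCoeff (n : ℕ) {U : Opens X.pt} (i : Finset (Fin n)) : X.ThickSec n U →ₗ[ℝ] X.sec U :=
  GradedTensorProduct.coeff (Pi.basisFun ℝ (Fin n)).ExteriorAlgebra i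

theorem thickCoeff_res (n : ℕ) {U V : Opens X.pt} (h : U ≤ V) (i : Finset (Fin n)) (s : X.ThickSec n V) :
    X.thickCoeff n i (X.thickRes n h s) = X.res h (X.thickCoeff n i s) :=
  GradedTensorProduct.coeff_mapLeft _ _ _ _ _ i s

/-- The superspace `ℝ^{0|n} × X`, whose structure sheaf is the graded tensor product of that of `X`
with the Grassmann algebra. -/
noncomputable def thicken (n : ℕ) : Superspace where
  pt := X.pt
  sec U := X.ThickSec n U
  res h := X.thickRes n h
  res_self {U} s := by
    refine GradedTensorProduct.coeff_ext _ fun i => (X.thickCoeff_res n le_rfl i s).trans ?_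
    rw [X.res_self]
  res_res h k s := by
    refine GradedTensorProduct.coeff_ext (Pi.basisFun ℝ (Fin n)).ExteriorAlgebra fun i => ?_
    rw [thickCoeff_res, thickCoeff_res, thickCoeff_res, X.res_res]
  gr U := GradedTensorProduct.totalGr (X.gr U) (Grassmann.gr n)
  gr_graded _ := GradedTensorProduct.totalGr_gradedMonoid
  gr_internal _ := GradedTensorProduct.totalGr_isInternal
  res_gr _ i s hs := GradedTensorProduct.mapLeft_mem _ _ _ _ i s hs
  supercomm {U i j a b} ha hb := GradedTensorProduct.totalGr_supercommutative
    (X.supercommutative U) (Grassmann.supercommutative n) ha hb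
  separated V hV hc s t h := by
    refine GradedTensorProduct.coeff_ext (Pi.basisFun ℝ (Fin n)).ExteriorAlgebra fun i => ?_
    refine X.separated V hV hc _ _ fun j => ?_
    rw [← thickCoeff_res, ← thickCoeff_res, h j]
  glue {ι U} V hV hc s h := by
    have hg : ∀ i, ∃ t : X.sec U, ∀ j, X.res (hV j) t = X.thickCoeff n i (s j) := fun i =>
      X.glue V hV hc (fun j => X.thickCoeff n i (s j)) fun j k => by
        rw [← thickCoeff_res, ← thickCoeff_res, h j k]
    choose t ht using hg
    -- Each coefficient has been glued separately on `X`; the finite basis reassembles them into one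
    -- section.
    refine ⟨∑ i, t i ᵍ⊗ₜ (Pi.basisFun ℝ (Fin n)).ExteriorAlgebra i, fun j => ?_⟩
    refine GradedTensorProduct.coeff_ext (Pi.basisFun ℝ (Fin n)).ExteriorAlgebra fun i => ?_
    rw [thickCoeff_res, GradedTensorProduct.coeff_sum, ht]

end

section

variable (X : Superspace) (n : ℕ)

theorem thick_supercommutative (U : Opens X.pt) :
    Supercommutative (GradedTensorProduct.totalGr (X.gr U) (Grassmann.gr n)) :=
  GradedTensorProduct.totalGr_supercommutative (X.supercommutative U) (Grassmann.supercommutative n)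

/-- Setting the odd coordinates of `ℝ^{0|n}` to zero. -/
noncomputable def body (U : Opens X.pt) : X.ThickSec n U →ₐ[ℝ] X.sec U :=
  Grassmann.body (X.supercommutative U)

variable {n}

theorem body_tmul {U : Opens X.pt} (s : X.sec U) (b : Grassmann n) :
    X.body n U (s ᵍ⊗ₜ b) = Grassmann.aug n b • s :=
  Grassmann.body_tmul _ s b

theorem body_res {U V : Opens X.pt} (h : U ≤ V) (t : X.ThickSec n V) :
    X.body n U (X.thickRes n h t) = X.res h (X.body n V t) := by
  induction t using GradedTensorProduct.induction_tmul with
  | zero => simp only [map_zero]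
  | tmul a b => rw [thickRes_tmul, body_tmul, body_tmul, map_smul]
  | add s t hs ht => simp only [map_add, hs, ht]

theorem isUnit_body_iff {U : Opens X.pt} (t : X.ThickSec n U) :
    IsUnit (X.body n U t) ↔ IsUnit t :=
  Grassmann.isUnit_body_iff (X.supercommutative U) t

theorem invertibleAt_body_iff {U : Opens X.pt} (t : X.ThickSec n U) (x : X.pt) :
    X.InvertibleAt (X.body n U t) x ↔ (X.thicken n).InvertibleAt (U := U) t x := by
  refine exists_congr fun W => exists_congr fun h => and_congr_right fun _ => ?_
  rw [← body_res]
  exact X.isUnit_body_iff _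

variable (n)

/-- The inclusion of the sections of `X` into those of `ℝ^{0|n} × X`. -/
noncomputable def inclLeft (U : Opens X.pt) : X.sec U →ₐ[ℝ] X.ThickSec n U :=
  GradedTensorProduct.includeLeft (X.gr U) (Grassmann.gr n)

/-- The inclusion of the Grassmann algebra into the sections of `ℝ^{0|n} × X`. -/
noncomputable def inclRight (U : Opens X.pt) : Grassmann n →ₐ[ℝ] X.ThickSec n U :=
  GradedTensorProduct.includeRight (X.gr U) (Grassmann.gr n)

variable {n}

theorem res_inclLeft {U V : Opens X.pt} (h : U ≤ V) (s : X.sec V) :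
    X.thickRes n h (X.inclLeft n V s) = X.inclLeft n U (X.res h s) :=
  X.thickRes_tmul n h s 1

theorem res_inclRight {U V : Opens X.pt} (h : U ≤ V) (b : Grassmann n) :
    X.thickRes n h (X.inclRight n V b) = X.inclRight n U b :=
  (X.thickRes_tmul n h 1 b).trans (by rw [map_one]; rfl)

theorem inclLeft_mem (U : Opens X.pt) (i : ZMod 2) (s : X.sec U)
    (hs : s ∈ X.gr U i) :
    X.inclLeft n U s ∈ GradedTensorProduct.totalGr (X.gr U) (Grassmann.gr n) i :=
  GradedTensorProduct.includeLeft_mem i s hs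

theorem inclRight_mem (U : Opens X.pt) (i : ZMod 2) (b : Grassmann n)
    (hb : b ∈ Grassmann.gr n i) :
    X.inclRight n U b ∈ GradedTensorProduct.totalGr (X.gr U) (Grassmann.gr n) i :=
  GradedTensorProduct.includeRight_mem i b hb

theorem body_inclLeft {U : Opens X.pt} (s : X.sec U) :
    X.body n U (X.inclLeft n U s) = s :=
  (X.body_tmul s 1).trans (by rw [map_one, one_smul])

theorem sub_inclLeft_body_mem {U : Opens X.pt} (t : X.ThickSec n U) :
    t - X.inclLeft n U (X.body n U t) ∈ (X.thick_supercommutative n U).nilradical :=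
  Grassmann.sub_body_mem (X.supercommutative U) t

variable {X}

theorem thick_algHom_ext {U : Opens X.pt} {C : Type*} [Ring C]
    [Algebra ℝ C] {f g : X.ThickSec n U →ₐ[ℝ] C}
    (hl : ∀ s, f (X.inclLeft n U s) = g (X.inclLeft n U s))
    (hr : ∀ b, f (X.inclRight n U b) = g (X.inclRight n U b)) : f = g :=
  GradedTensorProduct.superAlgHom_ext hl hr

theorem InvertibleAt.add_nilradical {U : Opens X.pt} {s t : X.sec U} {x : X.pt}
    (hs : X.InvertibleAt s x) (ht : t ∈ (X.supercommutative U).nilradical) :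
    X.InvertibleAt (s + t) x := by
  obtain ⟨W, h, hx, hu⟩ := hs
  refine ⟨W, h, hx, ?_⟩
  rw [map_add]
  exact (X.supercommutative W).isUnit_add hu
    ((X.supercommutative U).map_mem_nilradical (X.supercommutative W) (X.res h) (X.res_gr h) ht)

end

/-- The projection `ℝ^{0|n} × X → X`. -/
noncomputable def thickenProj (X : Superspace) (n : ℕ) : X.thicken n ⟶ X where
  base := ContinuousMap.id X.pt
  app V := X.inclLeft n V
  app_res h s := (X.res_inclLeft h s).symm
  app_gr V i s hs := X.inclLeft_mem V i s hs
  -- The body of the pullback of `s` is `s`, so invertibility upstairs gives invertibility of `s`.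
  isLocal V s x _ h := by
    have := (X.invertibleAt_body_iff (X.inclLeft n V s) x).2 h
    exact (X.body_inclLeft s) ▸ this

/-! ### Morphisms to the product -/

section Lift

variable {X Y : Superspace} {n : ℕ} (f : Y ⟶ X) (u : Grassmann n →ₐ[ℝ] Y.sec ⊤)
  (hu : ∀ i, ∀ b ∈ Grassmann.gr n i, u b ∈ Y.gr ⊤ i)

/-- The homomorphisms of sections of `thickenLift`. -/
noncomputable def thickenLiftApp (V : Opens X.pt) :
    X.ThickSec n V →ₐ[ℝ] Y.sec (Opens.comap f.base V) :=
  GradedTensorProduct.superLift (Y.supercommutative _) (f.app V) ((Y.res le_top).comp u)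
    (f.app_gr V) (fun i b hb => Y.res_gr _ i _ (hu i b hb))

theorem thickenLiftApp_inclLeft (V : Opens X.pt) (s : X.sec V) :
    thickenLiftApp f u hu V (X.inclLeft n V s) = f.app V s :=
  (GradedTensorProduct.superLift_tmul _ _ _ _ _ s 1).trans (by rw [map_one, mul_one])

theorem thickenLiftApp_inclRight (V : Opens X.pt) (b : Grassmann n) :
    thickenLiftApp f u hu V (X.inclRight n V b) = Y.res le_top (u b) :=
  (GradedTensorProduct.superLift_tmul _ _ _ _ _ 1 b).trans (by rw [map_one, one_mul]; rfl)

theorem thickenLiftApp_mem (V : Opens X.pt) (i : ZMod 2) (s : X.ThickSec n V)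
    (hs : s ∈ GradedTensorProduct.totalGr (X.gr V) (Grassmann.gr n) i) :
    thickenLiftApp f u hu V s ∈ Y.gr _ i :=
  GradedTensorProduct.superLift_mem (Y.supercommutative _) _ _ _ _ i s hs

/-- Both sides are algebra homomorphisms in `s`, so it suffices to compare them on the two tensor
factors. -/
theorem thickenLiftApp_res {V W : Opens X.pt} (h : V ≤ W) (s : X.ThickSec n W) :
    thickenLiftApp f u hu V (X.thickRes n h s) =
      Y.res (OrderHomClass.mono (Opens.comap f.base) h) (thickenLiftApp f u hu W s) := by
  have e : (thickenLiftApp f u hu V).comp (X.thickRes n h) =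
      (Y.res (OrderHomClass.mono (Opens.comap f.base) h)).comp (thickenLiftApp f u hu W) := by
    refine thick_algHom_ext (fun s => ?_) (fun b => ?_)
    · rw [AlgHom.comp_apply, AlgHom.comp_apply, res_inclLeft, thickenLiftApp_inclLeft,
        thickenLiftApp_inclLeft, f.app_res]
    · rw [AlgHom.comp_apply, AlgHom.comp_apply, res_inclRight, thickenLiftApp_inclRight,
        thickenLiftApp_inclRight, Y.res_res]
  exact DFunLike.congr_fun e s

/-- The image of `s` and the pullback along `f` of its body differ by an element of the nilradical,
so the latter is invertible at `y` too. Locality of `f` then makes the body of `s` invertible at `f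
y`. -/
theorem thickenLiftApp_isLocal (V : Opens X.pt) (s : X.ThickSec n V) (y : Y.pt)
    (hy : f.base y ∈ V) (h : Y.InvertibleAt (thickenLiftApp f u hu V s) y) :
    (X.thicken n).InvertibleAt (U := V) s (f.base y) := by
  refine (invertibleAt_body_iff X _ _).1 (f.isLocal V _ y hy ?_)
  have hn := (X.thick_supercommutative n V).map_mem_nilradical (Y.supercommutative _)
    (thickenLiftApp f u hu V) (thickenLiftApp_mem f u hu V) (X.sub_inclLeft_body_mem s)
  rw [map_sub, thickenLiftApp_inclLeft] at hn
  have := h.add_nilradical (neg_mem hn)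
  rwa [neg_sub, add_sub_cancel] at this

/-- The morphism to `ℝ^{0|n} × X` with given components. -/
noncomputable def thickenLift : Y ⟶ X.thicken n where
  base := f.base
  app V := thickenLiftApp f u hu V
  app_res h s := thickenLiftApp_res f u hu h s
  app_gr V i s hs := thickenLiftApp_mem f u hu V i s hs
  isLocal V s y hy h := thickenLiftApp_isLocal f u hu V s y hy h

/-- The two section maps have different target types until the base maps are identified. Restriction
along the equality of preimages serves as the transport and avoids heterogeneous equality. -/
theorem hom_ext_of_base {A B : Superspace} {f g : A ⟶ B} (hb : f.base = g.base)
    (ha : ∀ (V : Opens B.pt) (s : B.sec V) (h : Opens.comap f.base V = Opens.comap g.base V),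
      f.app V s = A.res h.le (g.app V s)) : f = g := by
  obtain ⟨b, a, _, _, _⟩ := f
  obtain ⟨b', a', _, _, _⟩ := g
  obtain rfl : b = b' := hb
  obtain rfl : a = a' := funext fun V => AlgHom.ext fun s => by
    simpa only [A.res_self] using ha V s rfl
  rfl

theorem thickenLift_proj : thickenLift f u hu ≫ X.thickenProj n = f :=
  hom_ext_of_base rfl fun V s _ =>
    (thickenLiftApp_inclLeft f u hu V s).trans (Y.res_self (f.app V s)).symm

/-- The homomorphisms of sections of a morphism to `ℝ^{0|n} × X`. -/
def thickApp (m : Y ⟶ X.thicken n) (V : Opens X.pt) :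
    X.ThickSec n V →ₐ[ℝ] Y.sec (Opens.comap m.base V) :=
  m.app V

/-- The homomorphism from the Grassmann algebra given by a morphism to `ℝ^{0|n} × X`. -/
noncomputable def oddPart (m : Y ⟶ X.thicken n) : Grassmann n →ₐ[ℝ] Y.sec ⊤ :=
  (thickApp m ⊤).comp (X.inclRight n ⊤)

theorem thickApp_inclRight (m : Y ⟶ X.thicken n) (V : Opens X.pt) (b : Grassmann n) :
    thickApp m V (X.inclRight n V b) =
      Y.res (le_top : Opens.comap m.base V ≤ ⊤) (oddPart m b) :=
  (congrArg (thickApp m V) (X.res_inclRight le_top b).symm).trans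
    (m.app_res (le_top : V ≤ (⊤ : Opens X.pt)) (X.inclRight n ⊤ b))

theorem oddPart_thickenLift : oddPart (thickenLift f u hu) = u := by
  refine AlgHom.ext fun b => ?_
  refine (thickenLiftApp_inclRight f u hu ⊤ b).trans ?_
  exact Y.res_self (u b)

/-- The uniqueness half of the universal property: sections over each open set are generated by
those of `X`, controlled by the projection, and by the Grassmann algebra, controlled by `oddPart`.
-/
theorem thicken_hom_ext {m m' : Y ⟶ X.thicken n}
    (hp : m ≫ X.thickenProj n = m' ≫ X.thickenProj n) (ho : oddPart m = oddPart m') : m = m' := by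
  have hb : m.base = m'.base := congrArg (fun f : Y ⟶ X => f.base) hp
  have hl : ∀ (V : Opens X.pt) (s : X.sec V)
      (h : Opens.comap m.base V = Opens.comap m'.base V),
      thickApp m V (X.inclLeft n V s) = Y.res h.le (thickApp m' V (X.inclLeft n V s)) := by
    have key : ∀ {f g : Y ⟶ X}, f = g → ∀ (V : Opens X.pt) (s : X.sec V)
        (h : Opens.comap f.base V = Opens.comap g.base V),
        f.app V s = Y.res h.le (g.app V s) := by
      rintro f _ rfl V s h
      rw [Y.res_self]
    exact key hp
  refine hom_ext_of_base hb fun V s h => ?_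
  have e : thickApp m V = (Y.res h.le).comp (thickApp m' V) := by
    refine thick_algHom_ext (X := X) (n := n) (fun s => hl V s h) (fun b => ?_)
    refine (thickApp_inclRight m V b).trans ?_
    rw [ho]
    refine Eq.trans ?_ (congrArg (Y.res h.le) (thickApp_inclRight m' V b)).symm
    rw [Y.res_res]
  exact DFunLike.congr_fun e s

end Lift

/-- The functoriality of `ℝ^{0|n} × X` in `X`. -/
noncomputable def thickenMap {X Y : Superspace} (n : ℕ) (f : X ⟶ Y) : X.thicken n ⟶ Y.thicken n :=
  thickenLift (X.thickenProj n ≫ f) (X.inclRight n ⊤) (X.inclRight_mem ⊤)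

theorem oddPart_comp_thickenMap {X Y Z : Superspace} {n : ℕ} (m : Z ⟶ X.thicken n) (f : X ⟶ Y) :
    oddPart (m ≫ thickenMap n f) = oddPart m := by
  have h := oddPart_thickenLift (X.thickenProj n ≫ f) (X.inclRight n ⊤) (X.inclRight_mem ⊤)
  refine AlgHom.ext fun b => ?_
  exact congrArg (thickApp m ⊤) (DFunLike.congr_fun h b)

theorem thickenMap_proj {X Y : Superspace} {n : ℕ} (f : X ⟶ Y) :
    thickenMap n f ≫ Y.thickenProj n = X.thickenProj n ≫ f :=
  thickenLift_proj _ _ _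

/-- The isomorphism of the products with `ℝ^{0|n}` given by an isomorphism. -/
noncomputable def thickenIso {X Y : Superspace} (n : ℕ) (e : X ≅ Y) : X.thicken n ≅ Y.thicken n where
  hom := thickenMap n e.hom
  inv := thickenMap n e.inv
  hom_inv_id := by
    refine thicken_hom_ext ?_ ?_
    · rw [Category.assoc, thickenMap_proj, ← Category.assoc, thickenMap_proj, Category.assoc,
        e.hom_inv_id, Category.comp_id, Category.id_comp]
    · rw [oddPart_comp_thickenMap, ← Category.id_comp (thickenMap n e.hom),
        oddPart_comp_thickenMap]
  inv_hom_id := by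
    refine thicken_hom_ext ?_ ?_
    · rw [Category.assoc, thickenMap_proj, ← Category.assoc, thickenMap_proj, Category.assoc,
        e.inv_hom_id, Category.comp_id, Category.id_comp]
    · rw [oddPart_comp_thickenMap, ← Category.id_comp (thickenMap n e.inv),
        oddPart_comp_thickenMap]

end Superspace

/-! ## The product of `ℝ^{0|n}` with a supermanifold is a supermanifold -/

/-- If the image of `a₀ + a₁` is even, then the image of `a₁` is both even and odd, hence zero, and
injectivity gives `a₁ = 0`; likewise for odd images. This shows that `splitHom` preserves the
grading. -/
theorem mem_of_injective_of_map_mem {A B : Type*} [Ring A] [Algebra ℝ A] [Ring B] [Algebra ℝ B]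
    {𝒜 : ZMod 2 → Submodule ℝ A} {ℬ : ZMod 2 → Submodule ℝ B} [GradedAlgebra 𝒜] [GradedAlgebra ℬ]
    {f : A →ₐ[ℝ] B} (hf : ∀ i, ∀ a ∈ 𝒜 i, f a ∈ ℬ i) (hi : Function.Injective f) (i : ZMod 2)
    {a : A} (ha : f a ∈ ℬ i) : a ∈ 𝒜 i := by
  have hd := Submodule.disjoint_def.1 (isCompl_even_odd (𝒜 := ℬ)).disjoint
  obtain ⟨a₀, h₀, a₁, h₁, rfl⟩ := exists_even_add_odd (𝒜 := 𝒜) a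
  rw [map_add] at ha
  obtain rfl | rfl : i = 0 ∨ i = 1 := by clear ha; revert i; decide
  · have h := hd (f a₁) (by simpa using sub_mem ha (hf 0 a₀ h₀)) (hf 1 a₁ h₁)
    rw [hi (h.trans (map_zero f).symm), add_zero]
    exact h₀
  · have h := hd (f a₀) (hf 0 a₀ h₀) (by simpa using sub_mem ha (hf 1 a₁ h₁))
    rw [hi (h.trans (map_zero f).symm), zero_add]
    exact h₁

theorem Superspace.mem_gr_of_injective (B : Superspace) (U : Opens B.pt) {A : Type*} [Ring A]
    [Algebra ℝ A] {𝒜 : ZMod 2 → Submodule ℝ A} [GradedAlgebra 𝒜] {f : A →ₐ[ℝ] B.sec U}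
    (hf : ∀ i, ∀ a ∈ 𝒜 i, f a ∈ B.gr U i) (hi : Function.Injective f) (i : ZMod 2)
    {a : A} (ha : f a ∈ B.gr U i) : a ∈ 𝒜 i :=
  mem_of_injective_of_map_mem hf hi i ha

theorem IsSmoothGrassmann.linear_comp {p q r : ℕ} {U : Opens (EuclideanSpace ℝ (Fin p))}
    {f : U → Grassmann q} (hf : IsSmoothGrassmann U f) (L : Grassmann q →ₗ[ℝ] Grassmann r) :
    IsSmoothGrassmann U fun x => L (f x) :=
  fun φ => hf (φ ∘ₗ L)

namespace Grassmann

theorem algHom_mem {q : ℕ} {A : Type*} [Ring A] [Algebra ℝ A] {𝒜 : ZMod 2 → Submodule ℝ A}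
    [SetLike.GradedMonoid 𝒜] (f : Grassmann q →ₐ[ℝ] A)
    (hf : ∀ v, f (ExteriorAlgebra.ι ℝ v) ∈ 𝒜 1) (i : ZMod 2) (a : Grassmann q)
    (ha : a ∈ gr q i) : f a ∈ 𝒜 i := by
  have key : ∀ (j : ZMod 2) (v w : Fin q → ℝ) (x : Grassmann q), f x ∈ 𝒜 j →
      f (ExteriorAlgebra.ι ℝ v * ExteriorAlgebra.ι ℝ w * x) ∈ 𝒜 j := by
    intro j v w x hx
    rw [map_mul, map_mul]
    have := SetLike.GradedMul.mul_mem (SetLike.GradedMul.mul_mem (hf v) (hf w)) hx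
    have h2 : ∀ j : ZMod 2, 1 + 1 + j = j := by decide
    rwa [h2] at this
  obtain rfl | rfl : i = 0 ∨ i = 1 := by clear ha; revert i; decide
  · induction a, ha using CliffordAlgebra.even_induction with
    | algebraMap r => rw [AlgHom.commutes]; exact SetLike.algebraMap_mem_graded 𝒜 r
    | add x y hx hy h1 h2 => rw [map_add]; exact add_mem h1 h2
    | ι_mul_ι_mul v w x hx h => exact key 0 v w x h
  · induction a, ha using CliffordAlgebra.odd_induction with
    | ι v => exact hf v
    | add x y hx hy h1 h2 => rw [map_add]; exact add_mem h1 h2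
    | ι_mul_ι_mul v w x hx h => exact key 1 v w x h

theorem map_mem {q r : ℕ} (f : (Fin q → ℝ) →ₗ[ℝ] (Fin r → ℝ)) (i : ZMod 2) (a : Grassmann q)
    (ha : a ∈ gr q i) : ExteriorAlgebra.map f a ∈ gr r i :=
  algHom_mem _ (fun v => by rw [ExteriorAlgebra.map_apply_ι]; exact ι_mem_gr _) i a ha

/-! ### The Grassmann algebra on `q + n` generators as a graded tensor product. -/

section Append

variable (q n : ℕ)

/-- Concatenation of vectors. -/
def append : ((Fin q → ℝ) × (Fin n → ℝ)) ≃ₗ[ℝ] (Fin (q + n) → ℝ) :=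
  (LinearEquiv.sumArrowLequivProdArrow (Fin q) (Fin n) ℝ ℝ).symm.trans
    (LinearEquiv.funCongrLeft ℝ ℝ finSumFinEquiv.symm)

/-- The multiplication map from the tensor product of two Grassmann algebras. -/
noncomputable def ofTensor : GradedTensorProduct ℝ (gr q) (gr n) →ₐ[ℝ] Grassmann (q + n) :=
  GradedTensorProduct.superLift (supercommutative (q + n))
    (ExteriorAlgebra.map ((append q n).toLinearMap ∘ₗ LinearMap.inl ℝ _ _))
    (ExteriorAlgebra.map ((append q n).toLinearMap ∘ₗ LinearMap.inr ℝ _ _))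
    (map_mem _) (map_mem _)

theorem ofTensor_mem (i : ZMod 2) (t : GradedTensorProduct ℝ (gr q) (gr n))
    (ht : t ∈ GradedTensorProduct.totalGr (gr q) (gr n) i) : ofTensor q n t ∈ gr (q + n) i :=
  GradedTensorProduct.superLift_mem (supercommutative (q + n)) _ _ _ _ i t ht

/-- The generators of the tensor product of two Grassmann algebras. -/
noncomputable def tensorι :
    (Fin (q + n) → ℝ) →ₗ[ℝ] GradedTensorProduct ℝ (gr q) (gr n) :=
  LinearMap.coprod
    ((GradedTensorProduct.includeLeft (gr q) (gr n)).toLinearMap ∘ₗ ExteriorAlgebra.ι ℝ)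
    ((GradedTensorProduct.includeRight (gr q) (gr n)).toLinearMap ∘ₗ ExteriorAlgebra.ι ℝ) ∘ₗ
    (append q n).symm.toLinearMap

theorem tensorι_append (v : Fin q → ℝ) (w : Fin n → ℝ) :
    tensorι q n (append q n (v, w)) =
      GradedTensorProduct.includeLeft (gr q) (gr n) (ExteriorAlgebra.ι ℝ v) +
      GradedTensorProduct.includeRight (gr q) (gr n) (ExteriorAlgebra.ι ℝ w) := by
  simp only [tensorι, LinearMap.comp_apply, LinearEquiv.coe_coe, LinearEquiv.symm_apply_apply,
    LinearMap.coprod_apply, AlgHom.toLinearMap_apply]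

theorem tensorι_mem (v : Fin (q + n) → ℝ) :
    tensorι q n v ∈ GradedTensorProduct.totalGr (gr q) (gr n) 1 := by
  obtain ⟨⟨v, w⟩, rfl⟩ := (append q n).surjective v
  rw [tensorι_append]
  exact add_mem (GradedTensorProduct.includeLeft_mem 1 _ (ι_mem_gr v))
    (GradedTensorProduct.includeRight_mem 1 _ (ι_mem_gr w))

/-- The inverse of `ofTensor`. -/
noncomputable def toTensor : Grassmann (q + n) →ₐ[ℝ] GradedTensorProduct ℝ (gr q) (gr n) :=
  ExteriorAlgebra.lift ℝ ⟨tensorι q n, fun v =>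
    (GradedTensorProduct.totalGr_supercommutative (supercommutative q)
      (supercommutative n)).sq_odd (tensorι_mem q n v)⟩

theorem toTensor_ι (v : Fin (q + n) → ℝ) :
    toTensor q n (ExteriorAlgebra.ι ℝ v) = tensorι q n v :=
  ExteriorAlgebra.lift_ι_apply ℝ _ _ v

theorem ofTensor_left (a : Grassmann q) :
    ofTensor q n (GradedTensorProduct.includeLeft (gr q) (gr n) a) =
      ExteriorAlgebra.map ((append q n).toLinearMap ∘ₗ LinearMap.inl ℝ _ _) a :=
  (GradedTensorProduct.superLift_tmul _ _ _ _ _ a 1).trans (by rw [map_one, mul_one])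

theorem ofTensor_right (b : Grassmann n) :
    ofTensor q n (GradedTensorProduct.includeRight (gr q) (gr n) b) =
      ExteriorAlgebra.map ((append q n).toLinearMap ∘ₗ LinearMap.inr ℝ _ _) b :=
  (GradedTensorProduct.superLift_tmul _ _ _ _ _ 1 b).trans (by rw [map_one, one_mul])

theorem ofTensor_toTensor (a : Grassmann (q + n)) : ofTensor q n (toTensor q n a) = a := by
  have e : (ofTensor q n).comp (toTensor q n) = AlgHom.id ℝ _ := by
    refine ExteriorAlgebra.hom_ext (LinearMap.ext fun v => ?_)
    obtain ⟨⟨v, w⟩, rfl⟩ := (append q n).surjective v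
    simp only [LinearMap.comp_apply, AlgHom.toLinearMap_apply, AlgHom.comp_apply, toTensor_ι,
      tensorι_append, map_add, ofTensor_left, ofTensor_right, ExteriorAlgebra.map_apply_ι,
      AlgHom.id_apply]
    rw [← map_add, LinearMap.inl_apply, LinearMap.inr_apply, ← map_add, Prod.mk_add_mk, add_zero,
      zero_add]
    rfl
  exact DFunLike.congr_fun e a

theorem toTensor_ofTensor (t : GradedTensorProduct ℝ (gr q) (gr n)) :
    toTensor q n (ofTensor q n t) = t := by
  have e : (toTensor q n).comp (ofTensor q n) = AlgHom.id ℝ _ := by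
    refine GradedTensorProduct.algHom_ext _ _ (ExteriorAlgebra.hom_ext (LinearMap.ext fun v => ?_))
      (ExteriorAlgebra.hom_ext (LinearMap.ext fun v => ?_))
    · simp only [LinearMap.comp_apply, AlgHom.toLinearMap_apply, AlgHom.comp_apply,
        ofTensor_left, ExteriorAlgebra.map_apply_ι, AlgHom.id_apply, toTensor_ι,
        LinearMap.inl_apply, LinearEquiv.coe_coe, tensorι_append, map_zero, add_zero]
    · simp only [LinearMap.comp_apply, AlgHom.toLinearMap_apply, AlgHom.comp_apply,
        ofTensor_right, ExteriorAlgebra.map_apply_ι, AlgHom.id_apply, toTensor_ι,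
        LinearMap.inr_apply, LinearEquiv.coe_coe, tensorι_append, map_zero, zero_add]
  exact DFunLike.congr_fun e t

end Append

end Grassmann

/-! ### Sections on `ℝ^{p|q}` -/

namespace superEuclidean

open Superspace

/-- The value, in the Grassmann algebra, of a section on `ℝ^{p|q}` at a point. -/
def eval {p q : ℕ} {W : Opens (superEuclidean p q).pt} (x : W) :
    (superEuclidean p q).sec W →ₐ[ℝ] Grassmann q where
  toFun f := (f : smoothGrassmann p q W).1 x
  map_one' := rfl
  map_mul' _ _ := rfl
  map_zero' := rfl
  map_add' _ _ := rfl
  commutes' _ := rfl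

theorem ext_eval {p q : ℕ} {W : Opens (superEuclidean p q).pt} {s t : (superEuclidean p q).sec W}
    (h : ∀ x : W, eval x s = eval x t) : s = t :=
  Subtype.ext (funext h)

variable {p q n : ℕ}

theorem eval_mem {W : Opens (superEuclidean p q).pt} (x : W) (i : ZMod 2)
    (s : (superEuclidean p q).sec W) (hs : s ∈ (superEuclidean p q).gr W i) :
    eval x s ∈ Grassmann.gr q i :=
  hs x

theorem eval_res {W W' : Opens (superEuclidean p q).pt} (h : W ≤ W') (x : W)
    (s : (superEuclidean p q).sec W') :
    eval x ((superEuclidean p q).res h s) = eval (⟨x.1, h x.2⟩ : W') s :=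
  rfl

/-- The value at a point of a section on `ℝ^{0|n} × ℝ^{p|q}`. -/
noncomputable def thickEval {W : Opens (superEuclidean p q).pt} (x : W) :
    (superEuclidean p q).ThickSec n W →ₐ[ℝ]
      GradedTensorProduct ℝ (Grassmann.gr q) (Grassmann.gr n) :=
  GradedTensorProduct.mapLeft (Grassmann.supercommutative q) (Grassmann.supercommutative n)
    (eval x) (eval_mem x)

theorem thickEval_res {W W' : Opens (superEuclidean p q).pt} (h : W ≤ W') (x : W)
    (t : (superEuclidean p q).ThickSec n W') :
    thickEval x ((superEuclidean p q).thickRes n h t) = thickEval (⟨x.1, h x.2⟩ : W') t := by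
  refine GradedTensorProduct.coeff_ext (Pi.basisFun ℝ (Fin n)).ExteriorAlgebra fun i => ?_
  rw [thickEval, GradedTensorProduct.coeff_mapLeft, thickCoeff_res, eval_res, thickEval,
    GradedTensorProduct.coeff_mapLeft]

/-- On a pure tensor the function is a fixed linear map applied to a smooth one; sums of smooth
functions are smooth. -/
theorem isSmooth_thickEval {W : Opens (superEuclidean p q).pt}
    (t : (superEuclidean p q).ThickSec n W) :
    IsSmoothGrassmann W fun x => Grassmann.ofTensor q n (thickEval x t) := by
  induction t using GradedTensorProduct.induction_tmul with
  | zero =>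
    have e : (fun x : W => Grassmann.ofTensor q n (thickEval x 0)) = 0 :=
      funext fun x => by simp
    exact Eq.subst (motive := IsSmoothGrassmann W) e.symm (smoothGrassmann p (q + n) W).zero_mem
  | add s t hs ht =>
    have e : (fun x : W => Grassmann.ofTensor q n (thickEval x (s + t))) =
        (fun x => Grassmann.ofTensor q n (thickEval x s)) +
          fun x => Grassmann.ofTensor q n (thickEval x t) := funext fun x => by simp
    exact Eq.subst (motive := IsSmoothGrassmann W) e.symm
      ((smoothGrassmann p (q + n) W).add_mem hs ht)
  | tmul s b =>
    have e : (fun x : W => Grassmann.ofTensor q n (thickEval x (s ᵍ⊗ₜ b))) = fun x : W =>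
        ((Grassmann.ofTensor q n).toLinearMap ∘ₗ (GradedTensorProduct.of ℝ _ _).toLinearMap ∘ₗ
          (TensorProduct.mk ℝ _ _).flip b) (eval x s) :=
      funext fun x => congrArg (Grassmann.ofTensor q n)
        (GradedTensorProduct.mapLeft_tmul _ _ _ _ s b)
    exact Eq.subst (motive := IsSmoothGrassmann W) e.symm
      ((mem_smoothGrassmann.1 (show smoothGrassmann p q W from s).2).linear_comp _)

/-- The comparison of the sections on `ℝ^{0|n} × ℝ^{p|q}` and on `ℝ^{p|q+n}`. -/
noncomputable def mergeHom (n : ℕ) (W : Opens (superEuclidean p q).pt) :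
    (superEuclidean p q).ThickSec n W →ₐ[ℝ] smoothGrassmann p (q + n) W :=
  AlgHom.codRestrict (AlgHom.pi fun x => (Grassmann.ofTensor q n).comp (thickEval x))
    (smoothGrassmann p (q + n) W) fun t => isSmooth_thickEval t

theorem mergeHom_mem (W : Opens (superEuclidean p q).pt) (i : ZMod 2)
    (t : (superEuclidean p q).ThickSec n W)
    (ht : t ∈ GradedTensorProduct.totalGr ((superEuclidean p q).gr W) (Grassmann.gr n) i) :
    mergeHom n W t ∈ (superEuclidean p (q + n)).gr W i := fun x =>
  Grassmann.ofTensor_mem q n i _ (GradedTensorProduct.mapLeft_mem (Grassmann.supercommutative q)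
    (Grassmann.supercommutative n) (eval x) (eval_mem x) i t ht)

theorem mergeHom_res {W W' : Opens (superEuclidean p q).pt} (h : W ≤ W')
    (t : (superEuclidean p q).ThickSec n W') :
    mergeHom n W ((superEuclidean p q).thickRes n h t) =
      (superEuclidean p (q + n)).res h (mergeHom n W' t) :=
  Subtype.ext (funext fun x => congrArg (Grassmann.ofTensor q n) (thickEval_res h x t))

theorem mergeHom_injective (W : Opens (superEuclidean p q).pt) :
    Function.Injective (mergeHom n W) := by
  intro s t h
  refine GradedTensorProduct.coeff_ext (Pi.basisFun ℝ (Fin n)).ExteriorAlgebra fun i => ?_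
  refine ext_eval fun x => ?_
  have h1 : Grassmann.ofTensor q n (thickEval x s) = Grassmann.ofTensor q n (thickEval x t) :=
    congrFun (congrArg Subtype.val h) x
  have h2 := congrArg (Grassmann.toTensor q n) h1
  rw [Grassmann.toTensor_ofTensor, Grassmann.toTensor_ofTensor] at h2
  rw [← GradedTensorProduct.coeff_mapLeft (Grassmann.supercommutative q)
      (Grassmann.supercommutative n) (eval x) (eval_mem x),
    ← GradedTensorProduct.coeff_mapLeft (Grassmann.supercommutative q)
      (Grassmann.supercommutative n) (eval x) (eval_mem x)]
  exact congrArg _ h2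

theorem mergeHom_surjective (W : Opens (superEuclidean p q).pt) :
    Function.Surjective (mergeHom n W) := by
  intro g
  let b := (Pi.basisFun ℝ (Fin n)).ExteriorAlgebra
  let c : Finset (Fin n) → Grassmann (q + n) →ₗ[ℝ] Grassmann q := fun i =>
    GradedTensorProduct.coeff b i ∘ₗ (Grassmann.toTensor q n).toLinearMap
  -- The preimage is built from the coefficients of `g` with respect to the last `n` generators;
  -- they are smooth because taking a coefficient is linear.
  let G : Finset (Fin n) → (superEuclidean p q).sec W := fun i =>
    (⟨fun x => c i (g.1 x), (mem_smoothGrassmann.1 g.2).linear_comp (c i)⟩ : smoothGrassmann p q W)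
  refine ⟨∑ i, G i ᵍ⊗ₜ b i, Subtype.ext (funext fun x => ?_)⟩
  refine Eq.trans ?_ (Grassmann.ofTensor_toTensor q n (g.1 x))
  refine congrArg (Grassmann.ofTensor q n) (a₁ := thickEval x _) ?_
  refine GradedTensorProduct.coeff_ext b fun i => ?_
  refine (GradedTensorProduct.coeff_mapLeft _ _ _ (eval_mem x) b i _).trans ?_
  exact congrArg (eval x) (GradedTensorProduct.coeff_sum b G i)

/-- The identification of the sections on `ℝ^{0|n} × ℝ^{p|q}` with those on `ℝ^{p|q+n}`. -/
noncomputable def merge (n : ℕ) (W : Opens (superEuclidean p q).pt) :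
    (superEuclidean p q).ThickSec n W ≃ₐ[ℝ] smoothGrassmann p (q + n) W :=
  AlgEquiv.ofBijective (mergeHom n W) ⟨mergeHom_injective W, mergeHom_surjective W⟩

/-- The inverse of `mergeHom`. -/
noncomputable def splitHom (n : ℕ) (W : Opens (superEuclidean p q).pt) :
    smoothGrassmann p (q + n) W →ₐ[ℝ] (superEuclidean p q).ThickSec n W :=
  (merge n W).symm

theorem mergeHom_splitHom (W : Opens (superEuclidean p q).pt) (s : smoothGrassmann p (q + n) W) :
    mergeHom n W (splitHom n W s) = s :=
  (merge n W).apply_symm_apply s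

theorem splitHom_mergeHom (W : Opens (superEuclidean p q).pt)
    (t : (superEuclidean p q).ThickSec n W) : splitHom n W (mergeHom n W t) = t :=
  (merge n W).symm_apply_apply t

theorem splitHom_res {W W' : Opens (superEuclidean p q).pt} (h : W ≤ W')
    (s : (superEuclidean p (q + n)).sec W') :
    splitHom n W ((superEuclidean p (q + n)).res h s) =
      (superEuclidean p q).thickRes n h (splitHom n W' s) :=
  mergeHom_injective W ((mergeHom_splitHom W _).trans ((mergeHom_res h _).trans
    (congrArg ((superEuclidean p (q + n)).res h) (mergeHom_splitHom W' s))).symm)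

theorem splitHom_mem (W : Opens (superEuclidean p q).pt) (i : ZMod 2)
    (s : (superEuclidean p (q + n)).sec W) (hs : s ∈ (superEuclidean p (q + n)).gr W i) :
    splitHom n W s ∈
      GradedTensorProduct.totalGr ((superEuclidean p q).gr W) (Grassmann.gr n) i := by
  refine (superEuclidean p (q + n)).mem_gr_of_injective W (mergeHom_mem W)
    (mergeHom_injective W) i ?_
  exact (mergeHom_splitHom W s).symm ▸ hs

theorem isUnit_of_mergeHom {W : Opens (superEuclidean p q).pt}
    {t : (superEuclidean p q).ThickSec n W} (h : IsUnit (mergeHom n W t)) : IsUnit t :=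
  splitHom_mergeHom W t ▸ h.map (splitHom n W)

theorem isUnit_of_splitHom {W : Opens (superEuclidean p q).pt}
    {s : smoothGrassmann p (q + n) W} (h : IsUnit (splitHom n W s)) : IsUnit s :=
  mergeHom_splitHom W s ▸ h.map (mergeHom n W)

/-- The comparison morphism from an open subspace of `ℝ^{0|n} × ℝ^{p|q}` to one of `ℝ^{p|q+n}`. -/
noncomputable def splitRestrict (n : ℕ) (V : Opens (superEuclidean p q).pt) :
    ((superEuclidean p q).thicken n).restrict V ⟶ (superEuclidean p (q + n)).restrict V where
  base := ContinuousMap.id V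
  app W := splitHom n (image V W)
  app_res h s := splitHom_res (image_mono V h) s
  app_gr W i s hs := splitHom_mem (image V W) i s hs
  isLocal := by
    rintro W s x _ ⟨W', h, hx, hu⟩
    exact ⟨W', h, hx, isUnit_of_splitHom (Eq.subst
      (motive := fun t : (superEuclidean p q).ThickSec n (image V W') => IsUnit t)
      (splitHom_res (image_mono V h) s).symm hu)⟩

/-- The comparison morphism from an open subspace of `ℝ^{p|q+n}` to one of `ℝ^{0|n} × ℝ^{p|q}`. -/
noncomputable def mergeRestrict (n : ℕ) (V : Opens (superEuclidean p q).pt) :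
    (superEuclidean p (q + n)).restrict V ⟶ ((superEuclidean p q).thicken n).restrict V where
  base := ContinuousMap.id V
  app W := mergeHom n (image V W)
  app_res h s := mergeHom_res (image_mono V h) s
  app_gr W i s hs := mergeHom_mem (image V W) i s hs
  isLocal := by
    rintro W s x _ ⟨W', h, hx, hu⟩
    exact ⟨W', h, hx, isUnit_of_mergeHom (Eq.subst
      (motive := fun t : smoothGrassmann p (q + n) (image V W') => IsUnit t)
      (mergeHom_res (image_mono V h) s).symm hu)⟩

/-- Open subspaces of `ℝ^{0|n} × ℝ^{p|q}` and of `ℝ^{p|q+n}` are isomorphic. -/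
noncomputable def thickenRestrictIso (p q n : ℕ) (V : Opens (superEuclidean p q).pt) :
    ((superEuclidean p q).thicken n).restrict V ≅ (superEuclidean p (q + n)).restrict V where
  hom := splitRestrict n V
  inv := mergeRestrict n V
  hom_inv_id := hom_ext_of_base rfl fun W s _ =>
    (splitHom_mergeHom (image V W) s).trans (Superspace.res_self _ _).symm
  inv_hom_id := hom_ext_of_base rfl fun W s _ =>
    (mergeHom_splitHom (image V W) s).trans (Superspace.res_self _ _).symm

end superEuclidean

/-- Thickening commutes definitionally with restriction to an open subset, so a chart of `X`
thickens to a chart of the product, over the same open sets. -/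
theorem IsSupermanifold.thicken {X : Superspace} (hX : IsSupermanifold X) (n : ℕ) :
    IsSupermanifold (X.thicken n) := by
  obtain ⟨h2, hc, hl⟩ := hX
  refine ⟨h2, hc, fun x => ?_⟩
  obtain ⟨U, p, q, V, hx, ⟨e⟩⟩ := hl x
  exact ⟨U, p, q + n, V, hx,
    ⟨(Superspace.thickenIso n e).trans (superEuclidean.thickenRestrictIso p q n V)⟩⟩

/-! ## Morphisms to `ℝ^{0|n}` -/

namespace Superspace

theorem subsingleton_sec (X : Superspace) {U : Opens X.pt} (h : ∀ x, x ∉ U) :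
    Subsingleton (X.sec U) :=
  ⟨fun s t => X.separated (ι := Empty) (fun e => e.elim) (fun e => e.elim)
    (fun x hx => (h x hx).elim) s t fun e => e.elim⟩

end Superspace

/-- Otherwise `1 = 0` could be carried to a chart and evaluated at the image of `x`, giving `1 = 0`
in a Grassmann algebra. This excludes nilpotent units in the locality proof of `homOfAlgHom`. -/
theorem IsSupermanifold.nontrivial_sec {X : Superspace} (hX : IsSupermanifold X) {W : Opens X.pt}
    {x : X.pt} (hx : x ∈ W) : Nontrivial (X.sec W) := by
  by_contra hn
  rw [not_nontrivial_iff_subsingleton] at hn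
  obtain ⟨U, p, q, V, hU, ⟨e⟩⟩ := hX.2.2 x
  let W' : Opens (X.restrict U).pt := Opens.comap ⟨Subtype.val, continuous_subtype_val⟩ W
  have hle : Superspace.image U W' ≤ W := by
    rintro _ ⟨y, hy, rfl⟩
    exact hy
  have h1 : (1 : (X.restrict U).sec W') = 0 := by
    have := congrArg (X.res hle) (Subsingleton.elim (1 : X.sec W) 0)
    rwa [map_one, map_zero] at this
  have h2 := congrArg (e.inv.app W') h1
  rw [map_one, map_zero] at h2
  let x' : (X.restrict U).pt := ⟨x, hU⟩
  have hx' : e.inv.base (e.hom.base x') = x' :=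
    congrArg (fun f : X.restrict U ⟶ X.restrict U => f.base x') e.hom_inv_id
  have hy : e.hom.base x' ∈ Opens.comap e.inv.base W' :=
    show e.inv.base (e.hom.base x') ∈ W' from hx'.symm ▸ hx
  have h3 : (1 : Grassmann q) = 0 :=
    congrFun (congrArg Subtype.val (show (1 : smoothGrassmann p q _) = 0 from h2))
      ⟨(e.hom.base x').1, _, hy, rfl⟩
  exact one_ne_zero h3

namespace superEuclidean

open Superspace

variable {n : ℕ}

theorem isSmooth_const {p : ℕ} (U : Opens (EuclideanSpace ℝ (Fin p))) (b : Grassmann n) :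
    IsSmoothGrassmann U fun _ => b :=
  fun _ => contMDiff_const

/-- The constant sections on `ℝ^{p|n}`. -/
def const (p n : ℕ) (V : Opens (superEuclidean p n).pt) :
    Grassmann n →ₐ[ℝ] (superEuclidean p n).sec V where
  toFun b := (⟨fun _ => b, isSmooth_const V b⟩ : smoothGrassmann p n V)
  map_one' := rfl
  map_mul' _ _ := rfl
  map_zero' := rfl
  map_add' _ _ := rfl
  commutes' _ := rfl

/-- The point of `ℝ^{0|n}`. -/
def origin (n : ℕ) : (superEuclidean 0 n).pt := (0 : EuclideanSpace ℝ (Fin 0))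

theorem eq_origin (x : (superEuclidean 0 n).pt) : x = origin n :=
  Subsingleton.elim (α := EuclideanSpace ℝ (Fin 0)) _ _

theorem const_eval {V : Opens (superEuclidean 0 n).pt} (h : origin n ∈ V)
    (s : (superEuclidean 0 n).sec V) :
    const 0 n V (eval (⟨origin n, h⟩ : V) s) = s :=
  ext_eval fun ⟨x, hx⟩ => by
    obtain rfl := eq_origin x
    rfl

variable {Y : Superspace} (u : Grassmann n →ₐ[ℝ] Y.sec ⊤)

/-- An open subset of a point contains it or is empty. In the empty case the target is the zero
ring, and the zero map is an algebra homomorphism. -/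
theorem exists_app (V : Opens (superEuclidean 0 n).pt) :
    ∃ a : (superEuclidean 0 n).sec V →ₐ[ℝ]
        Y.sec (Opens.comap (ContinuousMap.const Y.pt (origin n)) V),
      ∀ (h : origin n ∈ V) (s : (superEuclidean 0 n).sec V),
        a s = Y.res le_top (u (eval (⟨origin n, h⟩ : V) s)) := by
  by_cases h : origin n ∈ V
  · exact ⟨(Y.res le_top).comp (u.comp (eval (⟨origin n, h⟩ : V))), fun _ _ => rfl⟩
  · have := Y.subsingleton_sec (U := Opens.comap (ContinuousMap.const Y.pt (origin n)) V)
      fun _ hx => h hx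
    exact ⟨{ toFun := fun _ => 0
             map_one' := Subsingleton.elim _ _
             map_mul' := fun _ _ => Subsingleton.elim _ _
             map_zero' := Subsingleton.elim _ _
             map_add' := fun _ _ => Subsingleton.elim _ _
             commutes' := fun _ => Subsingleton.elim _ _ }, fun h' => (h h').elim⟩

/-- The morphism to `ℝ^{0|n}` given by a homomorphism from the Grassmann algebra. -/
noncomputable def homOfAlgHom (hY : ∀ {W : Opens Y.pt} {y : Y.pt}, y ∈ W → Nontrivial (Y.sec W))
    (hu : ∀ i, ∀ b ∈ Grassmann.gr n i, u b ∈ Y.gr ⊤ i) : Y ⟶ superEuclidean 0 n where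
  base := ContinuousMap.const Y.pt (origin n)
  app V := (exists_app u V).choose
  app_res {V W} h s := by
    by_cases h0 : origin n ∈ V
    · rw [(exists_app u V).choose_spec h0, (exists_app u W).choose_spec (h h0), Y.res_res, eval_res]
    · have := Y.subsingleton_sec (U := Opens.comap (ContinuousMap.const Y.pt (origin n)) V)
        fun _ hx => h0 hx
      exact Subsingleton.elim _ _
  app_gr V i s hs := by
    by_cases h0 : origin n ∈ V
    · rw [(exists_app u V).choose_spec h0]
      exact Y.res_gr _ i _ (hu i _ (eval_mem _ i s hs))
    · have := Y.subsingleton_sec (U := Opens.comap (ContinuousMap.const Y.pt (origin n)) V)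
        fun _ hx => h0 hx
      rw [Subsingleton.elim ((exists_app u V).choose s) 0]
      exact zero_mem _
  isLocal V s y h0 := by
    rintro ⟨W, h, hy, hs⟩
    have h0 : origin n ∈ V := h0
    rw [(exists_app u V).choose_spec h0, Y.res_res] at hs
    -- If the augmentation vanished, the value of `s` would be nilpotent, and its image would be a
    -- nilpotent unit in a nontrivial ring.
    have haug : Grassmann.aug n (eval (⟨origin n, h0⟩ : V) s) ≠ 0 := by
      intro ha
      have hm := Grassmann.sub_aug_mem (eval (⟨origin n, h0⟩ : V) s)
      rw [ha, map_zero, sub_zero] at hm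
      have hn := (Grassmann.supercommutative n).isNilpotent_of_mem hm
      have hn' := (hn.map u).map (Y.res (le_top : W ≤ ⊤))
      have := hY hy
      exact not_isUnit_zero (M₀ := Y.sec W) (by
        obtain ⟨k, hk⟩ := hn'
        rw [← hk]
        exact hs.pow k)
    refine ⟨V, le_rfl, h0, ?_⟩
    rw [(superEuclidean 0 n).res_self, ← const_eval h0 s]
    exact (Grassmann.isUnit_of_aug_ne_zero haug).map _

/-- The homomorphism from the Grassmann algebra given by a morphism to `ℝ^{0|n}`. -/
def algHomOfHom (m : Y ⟶ superEuclidean 0 n) : Grassmann n →ₐ[ℝ] Y.sec ⊤ :=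
  (m.app ⊤).comp (const 0 n ⊤)

theorem algHomOfHom_mem (m : Y ⟶ superEuclidean 0 n) (i : ZMod 2) (b : Grassmann n)
    (hb : b ∈ Grassmann.gr n i) : algHomOfHom m b ∈ Y.gr ⊤ i :=
  m.app_gr ⊤ i _ fun _ => hb

theorem algHomOfHom_homOfAlgHom
    (hY : ∀ {W : Opens Y.pt} {y : Y.pt}, y ∈ W → Nontrivial (Y.sec W))
    (hu : ∀ i, ∀ b ∈ Grassmann.gr n i, u b ∈ Y.gr ⊤ i) :
    algHomOfHom (homOfAlgHom u hY hu) = u :=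
  AlgHom.ext fun b =>
    ((exists_app u ⊤).choose_spec (Opens.mem_top _) (const 0 n ⊤ b)).trans (Y.res_self (u b))

/-- The target has one point, so only `V = ⊤` matters, where all sections are constant; over the
empty set there is nothing to compare. -/
theorem hom_ext {m m' : Y ⟶ superEuclidean 0 n} (h : algHomOfHom m = algHomOfHom m') : m = m' := by
  refine hom_ext_of_base (ContinuousMap.ext fun y => (eq_origin _).trans (eq_origin _).symm)
    fun V s hV => ?_
  by_cases h0 : origin n ∈ V
  · obtain rfl : V = ⊤ := by
      ext x
      rw [eq_origin x]
      exact ⟨fun _ => trivial, fun _ => h0⟩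
    rw [← const_eval h0 s]
    exact (DFunLike.congr_fun h _).trans (Y.res_self _).symm
  · have := Y.subsingleton_sec (U := Opens.comap m.base V) fun y hy =>
      h0 (eq_origin (m.base y) ▸ hy)
    exact Subsingleton.elim _ _

end superEuclidean

/-! ## The product `ℝ^{0|n} × N` -/

namespace SM

/-- The supermanifold `ℝ^{0|n} × N`. -/
noncomputable def thicken (n : ℕ) (N : SM) : SM :=
  ⟨N.obj.thicken n, N.property.thicken n⟩

/-- The projection `ℝ^{0|n} × N → N`. -/
noncomputable def thickenProj (n : ℕ) (N : SM) : N.thicken n ⟶ N :=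
  ObjectProperty.homMk (N.obj.thickenProj n)

/-- The projection `ℝ^{0|n} × N → ℝ^{0|n}`. -/
noncomputable def thickenCoord (n : ℕ) (N : SM) : N.thicken n ⟶ oddSpace n :=
  ObjectProperty.homMk (superEuclidean.homOfAlgHom (Y := N.obj.thicken n) (N.obj.inclRight n ⊤)
    (N.property.thicken n).nontrivial_sec (N.obj.inclRight_mem ⊤))

theorem algHomOfHom_comp_coord {n : ℕ} {N Y : SM} (m : Y ⟶ N.thicken n) :
    superEuclidean.algHomOfHom (m ≫ N.thickenCoord n).hom = Superspace.oddPart m.hom := by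
  have h := superEuclidean.algHomOfHom_homOfAlgHom (Y := N.obj.thicken n) (N.obj.inclRight n ⊤)
    (N.property.thicken n).nontrivial_sec (N.obj.inclRight_mem ⊤)
  refine AlgHom.ext fun b => ?_
  exact congrArg (Superspace.thickApp m.hom ⊤) (DFunLike.congr_fun h b)

/-- The two projections make `ℝ^{0|n} × N` a cartesian product in the category of
supermanifolds. -/
noncomputable def thickenIsLimit (n : ℕ) (N : SM) :
    Limits.IsLimit (Limits.BinaryFan.mk (N.thickenCoord n) (N.thickenProj n)) :=
  Limits.BinaryFan.isLimitMk
    (fun s => ObjectProperty.homMk (Superspace.thickenLift s.snd.hom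
      (superEuclidean.algHomOfHom s.fst.hom) (superEuclidean.algHomOfHom_mem s.fst.hom)))
    (fun s => by
      refine ObjectProperty.hom_ext _ (superEuclidean.hom_ext ?_)
      rw [algHomOfHom_comp_coord]
      exact Superspace.oddPart_thickenLift _ _ _)
    (fun s => ObjectProperty.hom_ext _ (Superspace.thickenLift_proj _ _ _))
    fun s m h1 h2 => by
      refine ObjectProperty.hom_ext _ (Superspace.thicken_hom_ext ?_ ?_)
      · exact (congrArg (fun f => f.hom) h2).trans (Superspace.thickenLift_proj _ _ _).symm
      · rw [← algHomOfHom_comp_coord, h1]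
        exact (Superspace.oddPart_thickenLift _ _ _).symm

end SM

/-! ### The projection is a submersion. -/

namespace Superspace

/-- The derivation, along a tangent vector of `X`, of the body of a section on `ℝ^{0|n} × X`. -/
noncomputable def TangentVector.compBody {X : Superspace} (n : ℕ) {x : X.pt}
    (w : X.TangentVector x) (U : Opens X.pt) (hx : x ∈ U) : X.ThickSec n U →ₗ[ℝ] ℝ :=
  w.toFun U hx ∘ₗ (X.body n U).toLinearMap

/-- The tangent vector of `ℝ^{0|n} × X` in the direction of `X` given by a tangent vector of `X`. -/
noncomputable def TangentVector.thicken {X : Superspace} (n : ℕ) {x : X.pt}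
    (w : X.TangentVector x) : (X.thicken n).TangentVector x where
  toFun U hx := w.compBody n U hx
  toFun_res {U V} h hx s := by
    refine Eq.trans ?_ (w.toFun_res h hx (X.body n V s))
    exact congrArg (w.toFun U hx) (X.body_res h s)
  leibniz := fun (U : Opens X.pt) hx a b c d ha hb => by
    -- Invertibility is detected on bodies, so a value of a section is a value of its body.
    have key : ∀ (a : X.ThickSec n U) (c : ℝ), (X.thicken n).HasValueAt (U := U) a x c →
        X.HasValueAt (X.body n U a) x c := by
      intro a c ha h
      refine ha ((X.invertibleAt_body_iff (a - algebraMap ℝ (X.ThickSec n U) c) x).1 ?_)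
      rwa [map_sub, AlgHom.commutes]
    refine Eq.trans ?_ (w.leibniz U hx (X.body n U a) (X.body n U b) c d (key a c ha) (key b d hb))
    exact congrArg (w.toFun U hx) (map_mul (X.body n U) (show X.ThickSec n U from a)
      (show X.ThickSec n U from b))

/-- Composing `w` with the body lifts it, since the body map is a left inverse of the pullback of
sections. -/
theorem isSubmersion_thickenProj (X : Superspace) (n : ℕ) : IsSubmersion (X.thickenProj n) :=
  fun x w => ⟨TangentVector.thicken (X := X) n (x := x) w, fun V hx s =>
    congrArg (w.toFun V hx) (X.body_inclLeft s).symm⟩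

end Superspace

namespace SSMn

/-- The object `ℝ^{0|n} × N → N`. -/
noncomputable def std (n : ℕ) (N : SM) : SSMn n :=
  ⟨⟨Arrow.mk (N.thickenProj n), Function.surjective_id, N.obj.isSubmersion_thickenProj n⟩,
    N.thickenCoord n, ⟨N.thickenIsLimit n⟩⟩

/-! ## Morphisms of `SSM_n` and the comparison of presheaves -/

variable {n : ℕ} {P Q S : SSMn n}

/-- As in the Yoneda lemma, the map of total spaces is recovered by evaluating `fibre` at the
universal point, the pair of projections of `P`. -/
theorem hom_ext' {h k : P ⟶ Q} (hb : onBase h = onBase k) (hf : fibre h = fibre k) : h = k := by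
  have ht : onTotal h = onTotal k := by
    have e : ∀ h : P ⟶ Q, onTotal h = Q.pair ((fibre h).app P.coord P.proj) (P.proj ≫ onBase h) := by
      intro h
      refine Q.pair_unique ?_ (Arrow.w h.hom.hom)
      have : P.pair P.coord P.proj = 𝟙 _ :=
        (P.pair_unique (Category.id_comp _) (Category.id_comp _)).symm
      change _ = P.pair P.coord P.proj ≫ onTotal h ≫ Q.coord
      rw [this, Category.id_comp]
    rw [e h, e k, hb, hf]
  exact ObjectProperty.hom_ext _ (ObjectProperty.hom_ext _ (Arrow.hom_ext _ _ ht hb))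

/-- The morphism of `SSM_n` with given components. -/
noncomputable def mkHom (P Q : SSMn n) (g : P.base ⟶ Q.base)
    (φ : InternalEnd (oddSpace n) P.base) : P ⟶ Q :=
  ObjectProperty.homMk (ObjectProperty.homMk
    (Arrow.homMk (Q.pair (φ.app P.coord P.proj) (P.proj ≫ g)) g (Q.pair_proj _ _)))

theorem onBase_mkHom (g : P.base ⟶ Q.base) (φ : InternalEnd (oddSpace n) P.base) :
    onBase (mkHom P Q g φ) = g := rfl

theorem fibre_mkHom (g : P.base ⟶ Q.base) (φ : InternalEnd (oddSpace n) P.base) :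
    fibre (mkHom P Q g φ) = φ := by
  refine InternalEnd.ext ?_
  funext Y u y
  change P.pair u y ≫ Q.pair (φ.app P.coord P.proj) (P.proj ≫ g) ≫ Q.coord = φ.app u y
  rw [pair_coord, ← φ.naturality, pair_coord, pair_proj]

theorem mkHom_comp (g : P.base ⟶ Q.base) (φ : InternalEnd (oddSpace n) P.base)
    (k : Q.base ⟶ S.base) (ψ : InternalEnd (oddSpace n) Q.base) :
    mkHom P Q g φ ≫ mkHom Q S k ψ = mkHom P S (g ≫ k) (ψ.pull g * φ) := by
  refine hom_ext' rfl ?_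
  rw [fibre_comp, fibre_mkHom, fibre_mkHom, fibre_mkHom, onBase_mkHom]

theorem mkHom_id : mkHom P P (𝟙 P.base) 1 = 𝟙 P :=
  hom_ext' rfl ((fibre_mkHom _ _).trans (fibre_id P).symm)

end SSMn

namespace InternalEnd

variable {C : Type*} [Category C] {R X X' : C}

theorem pull_id (φ : InternalEnd R X) : φ.pull (𝟙 X) = φ :=
  InternalEnd.ext (by funext Y u x; exact congrArg (φ.app u) (Category.comp_id x))

theorem pull_one (g : X' ⟶ X) : (1 : InternalEnd R X).pull g = 1 := rfl

end InternalEnd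

/-! ### Standard objects and the inverse construction. -/

namespace SSMn

variable {n : ℕ}

/-- The morphism of standard objects with given components. -/
noncomputable def stdHom {N N' : SM} (g : N ⟶ N') (φ : InternalEnd (oddSpace n) N) :
    std n N ⟶ std n N' :=
  mkHom (std n N) (std n N') g φ

theorem stdHom_id (N : SM) : stdHom (𝟙 N) (1 : InternalEnd (oddSpace n) N) = 𝟙 (std n N) :=
  mkHom_id

theorem stdHom_comp {N N' N'' : SM} (g : N ⟶ N') (φ : InternalEnd (oddSpace n) N)
    (k : N' ⟶ N'') (ψ : InternalEnd (oddSpace n) N') :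
    stdHom g φ ≫ stdHom k ψ = stdHom (g ≫ k) (ψ.pull g * φ) :=
  mkHom_comp (P := std n N) (Q := std n N') (S := std n N'') g φ k ψ

theorem fibre_stdHom {N N' : SM} (g : N ⟶ N') (φ : InternalEnd (oddSpace n) N) :
    fibre (stdHom g φ) = φ :=
  fibre_mkHom (P := std n N) (Q := std n N') g φ

/-- The canonical morphism from an object to the standard object with the same base. -/
noncomputable def toStd (P : SSMn n) : P ⟶ std n P.base :=
  mkHom P (std n P.base) (𝟙 P.base) 1

/-- The canonical morphism to an object from the standard object with the same base. -/
noncomputable def fromStd (P : SSMn n) : std n P.base ⟶ P :=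
  mkHom (std n P.base) P (𝟙 P.base) 1

theorem fibre_toStd (P : SSMn n) : fibre (toStd P) = 1 :=
  fibre_mkHom (Q := std n P.base) (𝟙 P.base) 1

theorem fibre_fromStd (P : SSMn n) : fibre (fromStd P) = 1 :=
  fibre_mkHom (P := std n P.base) (𝟙 P.base) 1

theorem toStd_fromStd (P : SSMn n) : toStd P ≫ fromStd P = 𝟙 P := by
  refine hom_ext' (Category.comp_id (𝟙 P.base)) ?_
  rw [fibre_comp, fibre_fromStd, fibre_toStd, fibre_id]
  rfl

theorem fromStd_toStd (P : SSMn n) : fromStd P ≫ toStd P = 𝟙 (std n P.base) := by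
  refine hom_ext' (Category.comp_id (𝟙 P.base)) ?_
  rw [fibre_comp, fibre_fromStd, fibre_toStd, fibre_id]
  rfl

theorem toStd_stdHom {P Q : SSMn n} (h : P ⟶ Q) :
    toStd P ≫ stdHom (𝟙 P.base) (fibre h) ≫ stdHom (onBase h) 1 = h ≫ toStd Q := by
  refine hom_ext' ?_ ?_
  · change 𝟙 P.base ≫ 𝟙 P.base ≫ onBase h = onBase h ≫ 𝟙 Q.base
    simp only [Category.id_comp, Category.comp_id]
  · rw [stdHom_comp, fibre_comp, fibre_comp, fibre_stdHom, fibre_toStd, fibre_toStd,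
      InternalEnd.pull_one, InternalEnd.pull_one, one_mul]
    exact (mul_one _).trans (InternalEnd.pull_id (fibre h))

theorem presheafOf_map_stdHom (G : EquivariantPresheaf.{w} (oddSpace n)) {N N' : SM}
    (g : N ⟶ N') (φ : InternalEnd (oddSpace n) N) (a : G.psh.obj (op N')) :
    (presheafOf G).map (stdHom g φ).op a = G.act (G.psh.map g.op a) φ := by
  change G.act (G.psh.map g.op a) (fibre (stdHom g φ)) = _
  rw [fibre_stdHom]

theorem presheafOf_map_toStd (G : EquivariantPresheaf.{w} (oddSpace n)) (P : SSMn n)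
    (a : G.psh.obj (op P.base)) : (presheafOf G).map (toStd P).op a = a := by
  change G.act (G.psh.map (𝟙 (op P.base)) a) (fibre (toStd P)) = a
  rw [fibre_toStd, G.act_one]
  simp

/-- The presheaf with an action on supermanifolds defined by a presheaf on `SSM_n`. -/
noncomputable def equivariantOf (H : (SSMn n)ᵒᵖ ⥤ Type w) :
    EquivariantPresheaf.{w} (oddSpace n) where
  psh :=
    { obj := fun N => H.obj (op (std n N.unop))
      map := fun g => H.map (stdHom g.unop 1).op
      map_id := fun N => (congrArg (fun k => H.map (Quiver.Hom.op k)) (stdHom_id N.unop)).trans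
        (H.map_id _)
      map_comp := fun g k => by
        rw [← H.map_comp, ← op_comp, stdHom_comp]
        rfl }
  act {X} a φ := H.map (stdHom (𝟙 X) φ).op a
  act_one {X} a := by
    rw [stdHom_id]
    simp
  act_mul {X} a φ ψ := by
    rw [← Functor.map_comp_apply, ← op_comp, stdHom_comp, InternalEnd.pull_id, Category.id_comp]
  map_act {X' X} g a φ := by
    -- Interchange rule: `(g, 1)` followed by `(𝟙, φ)` and `(𝟙, φ.pull g)` followed by `(g, 1)` are
    -- both `(g, φ.pull g)`.
    change H.map (stdHom g 1).op (H.map (stdHom (𝟙 X) φ).op a) =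
      H.map (stdHom (𝟙 X') (φ.pull g)).op (H.map (stdHom g 1).op a)
    rw [← Functor.map_comp_apply, ← Functor.map_comp_apply, ← op_comp, ← op_comp, stdHom_comp,
      stdHom_comp, InternalEnd.pull_one, mul_one, one_mul, Category.id_comp, Category.comp_id]

/-- Each presheaf on `SSM_n` is defined by a presheaf with an action on supermanifolds. -/
noncomputable def presheafOfEquivariantOf (H : (SSMn n)ᵒᵖ ⥤ Type w) :
    presheafOf (equivariantOf H) ≅ H :=
  NatIso.ofComponents
    (fun P =>
      { hom := H.map (toStd P.unop).op
        inv := H.map (fromStd P.unop).op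
        hom_inv_id := (H.map_comp _ _).symm.trans
          ((congrArg (fun k => H.map (Quiver.Hom.op k)) (fromStd_toStd P.unop)).trans (H.map_id _))
        inv_hom_id := (H.map_comp _ _).symm.trans
          ((congrArg (fun k => H.map (Quiver.Hom.op k)) (toStd_fromStd P.unop)).trans
            (H.map_id _)) })
    (fun {P Q} h => by
      ext (a : H.obj (op (std n P.unop.base)))
      change H.map (toStd Q.unop).op (H.map (stdHom (𝟙 Q.unop.base) (fibre h.unop)).op
        (H.map (stdHom (onBase h.unop) 1).op a)) = H.map h (H.map (toStd P.unop).op a)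
      rw [← Functor.map_comp_apply, ← Functor.map_comp_apply, ← Functor.map_comp_apply, ← op_comp,
        ← op_comp, Category.assoc, toStd_stdHom]
      rfl)

/-! ### The comparison functor is an equivalence. -/

instance comparison_faithful : (comparison.{w} n).Faithful where
  map_injective {F G t t'} h := by
    refine EquivariantPresheaf.Hom.ext (NatTrans.ext (funext fun N => ?_))
    exact congrArg (fun τ : presheafOf F ⟶ presheafOf G => τ.app (op (std n N.unop))) h

instance comparison_full : (comparison.{w} n).Full where
  map_surjective {F G} τ := by
    have key : ∀ {N N' : SM} (g : N ⟶ N') (φ : InternalEnd (oddSpace n) N)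
        (a : F.psh.obj (op N')), τ.app (op (std n N)) (F.act (F.psh.map g.op a) φ) =
          G.act (G.psh.map g.op (τ.app (op (std n N')) a)) φ := by
      intro N N' g φ a
      have h := NatTrans.naturality_apply τ (stdHom g φ).op a
      exact (congrArg _ (presheafOf_map_stdHom F g φ a).symm).trans
        (h.trans (presheafOf_map_stdHom G g φ _))
    -- The preimage consists of the components at standard objects. In `key`, the case `φ = 1` gives
    -- naturality and the case `g = 𝟙` gives equivariance.
    refine ⟨⟨{ app := fun N => τ.app (op (std n N.unop)), naturality := fun N N' g => ?_ },
      fun {X} a φ => ?_⟩, ?_⟩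
    · ext a
      exact (congrArg (fun b => τ.app (op (std n N'.unop)) b) (F.act_one (F.psh.map g a))).symm.trans
        ((key g.unop 1 a).trans (G.act_one _))
    · have hF : F.psh.map (𝟙 X).op a = a := by simp
      have hG : ∀ b, G.psh.map (𝟙 X).op b = b := by simp
      have := key (𝟙 X) φ a
      rw [hF] at this
      exact this.trans (congrArg (G.act · φ) (hG _))
    -- At an arbitrary object, naturality along `toStd` suffices, since both presheaves send this
    -- morphism to the identity.
    · refine NatTrans.ext (funext fun P => ?_)
      ext a
      have h := NatTrans.naturality_apply τ (toStd P.unop).op a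
      exact (presheafOf_map_toStd G P.unop _).symm.trans
        (h.symm.trans (congrArg _ (presheafOf_map_toStd F P.unop a)))

instance comparison_essSurj : (comparison.{w} n).EssSurj where
  mem_essImage H := ⟨equivariantOf H, ⟨presheafOfEquivariantOf H⟩⟩

end SSMn

theorem lemma9p1 (n : ℕ) :
    (∀ N : SM, ∃ P : SSMn n, P.base = N) ∧ (SSMn.comparison.{w} n).IsEquivalence :=
  ⟨fun N => ⟨SSMn.std n N, rfl⟩, {}⟩
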